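/- **Setting.** Let $d\ge 2$, let $\Omega\subseteq\mathbb{R}^d$ be open, $\delta_0>0$, and for $\rho>0$ let $\Omega^+_\rho:=\{x\in\mathbb{R}^d:\operatorname{dist}(x,\Omega)<\rho\}$. Let $B_\delta=\{z\in\mathbb{R}^d:|z|<\delta\}$. For each $\delta>0$ let $K_\delta:(0,\infty)\to[0,\infty)$ be Borel measurable with support in $[0,\delta]$, such that $\mathbf K_\delta(z):=K_\delta(|z|)z$ is integrable on $B_\delta$ and $m(\delta):=\int_{B_\delta}K_\delta(|z|)|z|^2\,dz>0$. Define $$\theta_\delta(x;u)=\frac{d}{m(\delta)}\int_{B_\delta}\mathbf K_\delta(z)\cdot u(x+z)\,dz,\qquad \mathcal A_\delta u(x)=\frac{C_{\mathcal A}}{m(\delta)}\int_{B_\delta}\mathbf K_\delta(z)\,\theta_\delta(x+z;u)\,dz,$$ $$\mathcal B_\delta u(x)=\frac{C_{\mathcal B}}{m(\delta)}\int_{B_\delta}\frac{\mathbf K_\delta(z)\otimes z}{|z|^2}\,\bigl(u(x+z)-u(x)\bigr)\,dz,$$ where the constants $C_{\mathcal A},C_{\mathcal B}$ are normalized by $$\frac{C_{\mathcal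 A}}{m(\delta)}\int_{B_\delta}\mathbf K_\delta(z)\otimes z\,dz=I,\qquad \frac{C_{\mathcal B}}{2m(\delta)}\int_{B_\delta}\frac{\mathbf K_\delta(z)\otimes z\otimes z\otimes z}{|z|^2}\,dz=I\otimes I+2I_{\mathrm{sym}}\quad(\delta>0),$$ with $(I_{\mathrm{sym}})_{ijkl}=\frac12(\delta_{ik}\delta_{jl}+\delta_{il}\delta_{jk})$ (that is, $C_{\mathcal A}=d$ and $C_{\mathcal B}=2d(d+2)$). The local operators are $$\mathcal A_0u=\partial\operatorname{div}u,\qquad \mathcal B_0u=\partial\operatorname{div}u+\operatorname{div}\bigl(\partial u+(\partial u)^{T}\bigr),$$ with weak derivatives. For real $s\ge0$ and $k=\lfloor s\rfloor$, $W^{s,2}(U;\mathbb{R}^d)$ is the space of $u$ whose weak derivatives of order at most $k$ are in $L^2(U)$ and whose seminorm $|u|_{W^{s,2}(U)}$ is finite, where $|u|_{W^{s,2}(U)}=\|\partial^ku\|_{L^2(U)}$ if $s=k$ and otherwise $$|u|^2_{W^{s,2}(U)}=\int_U\int_U\frac{|\partial^ku(y)-\partial^ku(x)|^2}{|y-x|^{d+2(s-k)}}\,dy\,dx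 .$$ **Theorem.** Let $0\le\alpha\le2$ and $u\in W^{2+\alpha,2}(\Omega^+_{\delta_0};\mathbb{R}^d)$. Then $\mathcal A_\delta u,\mathcal B_\delta u\in L^2(\Omega)$ for all $0<\delta\le\delta_0/2$, and: (a) If $\alpha=0$ or $\alpha=1$, then for each $\varepsilon>0$ there is a $\delta_1\in(0,\delta_0/2]$ such that for all $0<\delta\le\delta_1$ $$\|\mathcal A_\delta u-\mathcal A_0u\|_{L^2(\Omega)}<\varepsilon\delta^\alpha\quad\text{and}\quad\|\mathcal B_\delta u-\mathcal B_0u\|_{L^2(\Omega)}<\varepsilon\delta^\alpha .$$ (b) If $0<\alpha\le2$ and $\alpha\ne1$, then for all $0<\delta\le\delta_0/2$ $$\|\mathcal A_\delta u-\mathcal A_0u\|_{L^2(\Omega)}\le\Lambda'_\alpha\,|u|_{W^{2+\alpha,2}(\Omega^+_{\delta_0})}\,\delta^\alpha\quad\text{and}\quad\|\mathcal B_\delta u-\mathcal B_0u\|_{L^2(\Omega)}\le\Lambda'_\alpha\,|u|_{W^{2+\alpha,2}(\Omega^+_{\delta_0})}\,\delta^\alpha ,$$ with a constant $\Lambda'_\alpha$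 that depends only on $d$ and $\alpha$ (in particular not on $\delta$ or $u$). -/

import Mathlib

open MeasureTheory
open scoped ENNReal ContDiff

namespace Peridynamics

noncomputable section

/-- Euclidean space `ℝᵈ`. -/
abbrev E (d : ℕ) : Type := EuclideanSpace ℝ (Fin d)

/-! ### Weak derivatives and Sobolev spaces on open sets -/

/-- The classical iterated partial derivative `∂_{J 0} ⋯ ∂_{J (n-1)} φ` of a real function. -/
def partialDeriv {d n : ℕ} (J : Fin n → Fin d) (φ : E d → ℝ) (x : E d) : ℝ :=
  iteratedFDeriv ℝ n φ x (fun k => EuclideanSpace.single (J k) (1 : ℝ))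

/-- `g` is the weak derivative `∂_{J 0} ⋯ ∂_{J (n-1)} f` on the open set `U`:
both are locally integrable on `U`, and
`∫_U (∂_J φ) f = (-1)ⁿ ∫_U φ g` for all `φ ∈ C_c^∞(U)`. -/
def HasWeakDeriv {d n : ℕ} (U : Set (E d)) (J : Fin n → Fin d) (f g : E d → E d) : Prop :=
  LocallyIntegrableOn f U ∧ LocallyIntegrableOn g U ∧
    ∀ φ : E d → ℝ, ContDiff ℝ ∞ φ → HasCompactSupport φ → tsupport φ ⊆ U →
      ∫ x in U, partialDeriv J φ x • f x = (-1 : ℝ) ^ n • ∫ x in U, φ x • g x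

open Classical in
/-- The weak derivative `∂_J f` on `U` (unique up to null sets), with value `0` if there is none. -/
def weakDeriv {d n : ℕ} (U : Set (E d)) (J : Fin n → Fin d) (f : E d → E d) : E d → E d :=
  if h : ∃ g, HasWeakDeriv U J f g then h.choose else 0

/-- The square of the Gagliardo seminorm of order `r ∈ (0,1)`:
`∫_U ∫_U |w y - w x|² / |y - x|^(d + 2r) dy dx`. -/
def gagliardoSq {d : ℕ} (U : Set (E d)) (r : ℝ) (w : E d → E d) : ℝ≥0∞ :=
  ∫⁻ x in U, ∫⁻ y in U, ENNReal.ofReal (‖w y - w x‖ ^ 2 / ‖y - x‖ ^ ((d : ℝ) + 2 * r))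

/-- The Sobolev(-Slobodeckij) seminorm `|u|_{W^{s,2}(U)}` of order `s ≥ 0`.  With `k = ⌊s⌋`, it is
the `L²` norm of the tensor `∂ᵏu` if `s = k`, and the Gagliardo seminorm of order `s - k` of the
tensor `∂ᵏu` otherwise. -/
def sobolevSeminorm {d : ℕ} (s : ℝ) (U : Set (E d)) (u : E d → E d) : ℝ≥0∞ :=
  if s = (⌊s⌋₊ : ℝ) then
    (∑ J : Fin ⌊s⌋₊ → Fin d, eLpNorm (weakDeriv U J u) 2 (volume.restrict U) ^ 2) ^ (1 / 2 : ℝ)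
  else
    (∑ J : Fin ⌊s⌋₊ → Fin d, gagliardoSq U (s - ⌊s⌋₊) (weakDeriv U J u)) ^ (1 / 2 : ℝ)

/-- `u ∈ W^{s,2}(U; ℝᵈ)`, for real `s ≥ 0`: all weak derivatives of order at most `⌊s⌋` exist and
are in `L²(U)`, and the seminorm of order `s` is finite. -/
def MemSobolev {d : ℕ} (s : ℝ) (U : Set (E d)) (u : E d → E d) : Prop :=
  (∀ n : ℕ, n ≤ ⌊s⌋₊ → ∀ J : Fin n → Fin d,
      ∃ g, HasWeakDeriv U J u g ∧ MemLp g 2 (volume.restrict U)) ∧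
    sobolevSeminorm s U u < ⊤

/-! ### Local operators -/

/-- `∂ div u`, with components `∑_j ∂_i ∂_j u_j` (weak derivatives on `U`). -/
def gradDiv {d : ℕ} (U : Set (E d)) (u : E d → E d) (x : E d) : E d :=
  WithLp.toLp 2 fun i => ∑ j, weakDeriv U ![i, j] u x j

/-- `div (∂u + (∂u)ᵀ)`, with components `∑_j ∂_j (∂_j u_i + ∂_i u_j)` (weak derivatives
on `U`). -/
def divSymGrad {d : ℕ} (U : Set (E d)) (u : E d → E d) (x : E d) : E d :=
  WithLp.toLp 2 fun i => ∑ j, (weakDeriv U ![j, j] u x i + weakDeriv U ![j, i] u x j)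

/-! ### Nonlocal operators -/

/-- `K : (0,∞) → [0,∞)` is a radial kernel profile of horizon `δ`: Borel measurable, supported in
`[0,δ]`, and such that the vector kernel `z ↦ K(|z|) z` is integrable on `B_δ`. -/
structure IsKernel (d : ℕ) (δ : ℝ) (K : ℝ → ℝ) : Prop where
  measurable : Measurable K
  nonneg : ∀ r, 0 < r → 0 ≤ K r
  support : ∀ r, δ < r → K r = 0
  integrable : IntegrableOn (fun z : E d => K ‖z‖ • z) (Metric.ball 0 δ)

/-- The weighted volume `m(δ) = ∫_{B_δ} K(|z|) |z|² dz`. -/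
def weightedVolume (d : ℕ) (K : ℝ → ℝ) (δ : ℝ) : ℝ :=
  ∫ z in Metric.ball (0 : E d) δ, K ‖z‖ * ‖z‖ ^ 2

/-- The nonlocal dilatation `θ_δ(x; u) = d / m(δ) ∫_{B_δ} K(|z|) z ⬝ u(x + z) dz`. -/
def dilatation {d : ℕ} (K : ℝ → ℝ) (δ : ℝ) (u : E d → E d) (x : E d) : ℝ :=
  (d : ℝ) / weightedVolume d K δ *
    ∫ z in Metric.ball (0 : E d) δ, inner ℝ (K ‖z‖ • z) (u (x + z))

/-- `A_δ u(x) = C / m(δ) ∫_{B_δ} K(|z|) z θ_δ(x + z; u) dz`. -/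
def opA {d : ℕ} (C : ℝ) (K : ℝ → ℝ) (δ : ℝ) (u : E d → E d) (x : E d) : E d :=
  (C / weightedVolume d K δ) •
    ∫ z in Metric.ball (0 : E d) δ, dilatation K δ u (x + z) • (K ‖z‖ • z)

/-- `B_δ u(x) = C / m(δ) ∫_{B_δ} [K(|z|) z ⊗ z / |z|²] (u(x + z) - u(x)) dz`. -/
def opB {d : ℕ} (C : ℝ) (K : ℝ → ℝ) (δ : ℝ) (u : E d → E d) (x : E d) : E d :=
  (C / weightedVolume d K δ) •
    ∫ z in Metric.ball (0 : E d) δ,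
      (inner ℝ z (u (x + z) - u x) / ‖z‖ ^ 2) • (K ‖z‖ • z)

/-! ### Normalization of the scaling constants -/

/-- The components of the identity matrix. -/
def idTensor {d : ℕ} (i j : Fin d) : ℝ := if i = j then 1 else 0

/-- The components of the fourth-order symmetric identity tensor. -/
def symIdTensor {d : ℕ} (i j k l : Fin d) : ℝ :=
  1 / 2 * (idTensor i k * idTensor j l + idTensor i l * idTensor j k)

/-- `C / m(δ) ∫_{B_δ} K(|z|) z ⊗ z dz = I`. -/
def NormalizedA (d : ℕ) (C : ℝ) (K : ℝ → ℝ) (δ : ℝ) : Prop :=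
  ∀ i j : Fin d,
    C / weightedVolume d K δ * ∫ z in Metric.ball (0 : E d) δ, K ‖z‖ * z i * z j = idTensor i j

/-- `C / (2 m(δ)) ∫_{B_δ} K(|z|) z ⊗ z ⊗ z ⊗ z / |z|² dz = I ⊗ I + 2 I_sym`. -/
def NormalizedB (d : ℕ) (C : ℝ) (K : ℝ → ℝ) (δ : ℝ) : Prop :=
  ∀ i j k l : Fin d,
    C / (2 * weightedVolume d K δ) *
        ∫ z in Metric.ball (0 : E d) δ, K ‖z‖ * z i * z j * z k * z l / ‖z‖ ^ 2
      = idTensor i j * idTensor k l + 2 * symIdTensor i j k l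

end

end Peridynamics

/-!
# Consistency of two nonlocal approximations of second-order operators

Both operators superpose second differences of `u`.  With
`mixDiff f z w x = f(x+z+w) - f(x+z-w) - f(x-z+w) + f(x-z-w)`, the symmetry `z ↦ -z` of the kernel
turns `A_δ u` into an integral of mixed differences of `u` over pairs `(z, w)`, and `B_δ u` into an
integral of `mixDiff u (z/2) (z/2) = u(x+z) + u(x-z) - 2u(x)`.  To second order, `mixDiff f z w` is
`4 ∂_z ∂_w f`, and by the normalization of the constants the moments of the kernels turn this main
term into `A_0 u` and `B_0 u`.

The error is `∬ (∂_z∂_w f(x+sz+tw) - ∂_z∂_w f(x)) ds dt` over `[-1,1]²`.  As this square is symmetric,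
the difference of `∂²f` may be replaced by half of the symmetric second difference
`secDiff g h x = g(x+h) + g(x-h) - 2g(x)` of `g = ∂²f`.  Hence both errors are bounded in `L²(Ω)` by
a constant times `sup {‖secDiff ∂²u h‖ : |h| < 2δ}` (`VectorModulus.eLpNorm_opA_sub_le`,
`VectorModulus.eLpNorm_opB_sub_le`), and the rest is the modulus of `∂²u ∈ W^{α,2}`:

* for `0 < α < 1` the differences of `∂²u` are `O(|h|^α)`, because the Gagliardo seminorm controls
  the `L²` modulus of continuity (`eLpNorm_sub_translate_sq_le`);
* for `1 < α < 2` the second difference is `|h|` times a difference of `∂³u`, and for `α = 2` it is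
  `|h|²` times an average of `∂⁴u`;
* for `α = 0` and `α = 1` the differences of `∂²u` and `∂³u` tend to `0`, because translation is
  continuous in `L²`.

Taylor's formula is needed for weak derivatives on an open set.  It is obtained by duality: for a
test function `φ`, the correlation `corr φ f h = ∫ φ(x) f(x+h) dx` is a smooth function of `h`, whose
derivatives are correlations of `φ` with the weak derivatives of `f` (`IsTest.corr_fderiv`,
`IsTest.corr_fderiv_fderiv`).  The mean value inequality for this function bounds the tested finite
differences, and `L²(Ω)` norms are recovered from testing (`eLpNorm_le_of_forall_test`).
Minkowski's integral inequality (`eLpNorm_integral_le`) then carries the bounds through the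
integration against the kernel; it also yields the absolute convergence of the integrals for almost
every `x`, which in the case of `B_δ` is not automatic, as only `K(|z|) z` is integrable.
-/

namespace Peridynamics

variable {d : ℕ}

/-! ### Test functions and duality -/

/-- `φ` is a test function on `V`: smooth, with compact support contained in `V`. -/
structure IsTest (V : Set (E d)) (φ : E d → ℝ) : Prop where
  contDiff : ContDiff ℝ ∞ φ
  hasCompactSupport : HasCompactSupport φ
  tsupport_subset : tsupport φ ⊆ V

namespace IsTest

variable {U V : Set (E d)} {φ ψ : E d → ℝ}

lemma memLp (h : IsTest V φ) : MemLp φ 2 volume :=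
  h.contDiff.continuous.memLp_of_hasCompactSupport h.hasCompactSupport

lemma eq_zero (h : IsTest V φ) {x : E d} (hx : x ∉ V) : φ x = 0 :=
  image_eq_zero_of_notMem_tsupport fun h' => hx (h.tsupport_subset h')

lemma setIntegral_smul {F : Type*} [NormedAddCommGroup F] [NormedSpace ℝ F] (h : IsTest V φ)
    (f : E d → F) : ∫ x in V, φ x • f x = ∫ x, φ x • f x :=
  setIntegral_eq_integral_of_forall_compl_eq_zero fun x hx => by rw [h.eq_zero hx, zero_smul]

lemma add (h : IsTest V φ) (h' : IsTest V ψ) : IsTest V (fun x => φ x + ψ x) :=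
  ⟨h.contDiff.add h'.contDiff, h.hasCompactSupport.add h'.hasCompactSupport,
    (tsupport_add φ ψ).trans (Set.union_subset h.tsupport_subset h'.tsupport_subset)⟩

lemma const_mul (h : IsTest V φ) (c : ℝ) : IsTest V (fun x => c * φ x) :=
  ⟨contDiff_const.mul h.contDiff, h.hasCompactSupport.mul_left,
    (closure_mono (Function.support_mul_subset_right _ _)).trans h.tsupport_subset⟩

lemma fderiv_apply (h : IsTest V φ) (v : E d) : IsTest V (fun x => fderiv ℝ φ x v) := by
  refine ⟨(h.contDiff.fderiv_right (by simp)).clm_apply contDiff_const,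
    h.hasCompactSupport.fderiv_apply ℝ v, (tsupport_fderiv_apply_subset ℝ v).trans
      h.tsupport_subset⟩

lemma translate (h : IsTest V φ) {a : E d} (ha : ∀ x ∈ V, x + a ∈ U) :
    IsTest U (fun x => φ (x - a)) := by
  have e : (fun x => φ (x - a)) = φ ∘ (Homeomorph.subRight a) := rfl
  refine ⟨h.contDiff.comp (contDiff_id.sub contDiff_const), ?_, ?_⟩
  · rw [e]; exact h.hasCompactSupport.comp_homeomorph _
  · rw [e, tsupport_comp_eq_preimage]
    intro x hx
    simpa using ha _ (h.tsupport_subset hx)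

end IsTest

/-- The `L²` norm of a test function. -/
noncomputable def l2 (φ : E d → ℝ) : ℝ := (eLpNorm φ 2 volume).toReal

lemma l2_nonneg (φ : E d → ℝ) : 0 ≤ l2 φ := ENNReal.toReal_nonneg

/-- The Cauchy-Schwarz inequality for a test function on `V`, which sees only the `L²(V)` norm. -/
lemma IsTest.abs_integral_mul_le {V : Set (E d)} {φ F : E d → ℝ} (hφ : IsTest V φ)
    (hF : AEStronglyMeasurable F (volume.restrict V)) {C : ℝ} (hC : 0 ≤ C)
    (h : eLpNorm F 2 (volume.restrict V) ≤ ENNReal.ofReal C) :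
    |∫ x, φ x * F x| ≤ C * l2 φ := by
  have e := hφ.setIntegral_smul F
  simp only [smul_eq_mul] at e
  rw [← e, ← Real.norm_eq_abs]
  have h1 : ‖∫ x in V, φ x * F x‖ₑ ≤ ENNReal.ofReal (C * l2 φ) := by
    calc ‖∫ x in V, φ x * F x‖ₑ ≤ ∫⁻ x in V, ‖φ x * F x‖ₑ := enorm_integral_le_lintegral_enorm _
      _ = eLpNorm (φ • F) 1 (volume.restrict V) := by rw [eLpNorm_one_eq_lintegral_enorm]; rfl
      _ ≤ eLpNorm φ 2 (volume.restrict V) * eLpNorm F 2 (volume.restrict V) :=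
        eLpNorm_smul_le_mul_eLpNorm hF hφ.contDiff.continuous.aestronglyMeasurable
      _ ≤ eLpNorm φ 2 volume * ENNReal.ofReal C := by
        gcongr; exact Measure.restrict_le_self
      _ = _ := by
        rw [mul_comm, ENNReal.ofReal_mul hC, l2, ENNReal.ofReal_toReal hφ.memLp.2.ne]
  rw [← toReal_enorm]
  exact ENNReal.toReal_le_of_le_ofReal (mul_nonneg hC (l2_nonneg _)) h1

/-- `L²(V)` norms are computed by testing: the span of the test functions is dense in the Hilbert
space `L²(V)`, because by the fundamental lemma only zero is orthogonal to it. -/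
lemma eLpNorm_le_of_forall_test {V : Set (E d)} (hV : IsOpen V) {F : E d → ℝ}
    (hF : MemLp F 2 (volume.restrict V)) {C : ℝ} (hC : 0 ≤ C)
    (h : ∀ φ, IsTest V φ → |∫ x, φ x * F x| ≤ C * l2 φ) :
    eLpNorm F 2 (volume.restrict V) ≤ ENNReal.ofReal C := by
  let S : Submodule ℝ (Lp ℝ 2 (volume.restrict V)) :=
    { carrier := {f | ∃ φ, IsTest V φ ∧ f =ᵐ[volume.restrict V] φ}
      zero_mem' := ⟨fun _ => 0, ⟨contDiff_const, HasCompactSupport.zero, by simp [tsupport]⟩,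
        Lp.coeFn_zero _ _ _⟩
      add_mem' := by
        rintro f g ⟨φ, hφ, e⟩ ⟨ψ, hψ, e'⟩
        refine ⟨_, hφ.add hψ, ?_⟩
        filter_upwards [Lp.coeFn_add f g, e, e'] with x h1 h2 h3
        exact h1.trans (by rw [Pi.add_apply, h2, h3])
      smul_mem' := by
        rintro c f ⟨φ, hφ, e⟩
        refine ⟨_, hφ.const_mul c, ?_⟩
        filter_upwards [Lp.coeFn_smul c f, e] with x h1 h2
        simp [h1, h2] }
  have inner_eq : ∀ (f g : Lp ℝ 2 (volume.restrict V)) (φ G : E d → ℝ), IsTest V φ →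
      f =ᵐ[volume.restrict V] φ → g =ᵐ[volume.restrict V] G →
      inner ℝ f g = ∫ x, φ x * G x := by
    intro f g φ G hφ hf hg
    rw [MeasureTheory.L2.inner_def]
    have e := hφ.setIntegral_smul G
    simp only [smul_eq_mul] at e
    rw [← e]
    refine integral_congr_ae ?_
    filter_upwards [hf, hg] with x h1 h2
    simp [h1, h2, mul_comm]
  have hdense : S.topologicalClosure = ⊤ := by
    rw [Submodule.topologicalClosure_eq_top_iff, Submodule.eq_bot_iff]
    intro g hg
    have hg2 : MemLp g 2 (volume.restrict V) := Lp.memLp g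
    have hloc : LocallyIntegrableOn g V := by
      refine (locallyIntegrableOn_of_locallyIntegrable_restrict ?_)
      exact hg2.locallyIntegrable (by norm_num)
    have h0 := hV.ae_eq_zero_of_integral_contDiff_smul_eq_zero hloc (by
      intro φ h1 h2 h3
      have hφ : IsTest V φ := ⟨h1, h2, h3⟩
      have hm : MemLp φ 2 (volume.restrict V) := hφ.memLp.restrict V
      have := hg (hm.toLp φ) ⟨φ, hφ, hm.coeFn_toLp⟩
      rwa [inner_eq _ g φ g hφ hm.coeFn_toLp (by rfl)] at this)
    rw [Lp.eq_zero_iff_ae_eq_zero]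
    filter_upwards [(ae_restrict_iff' hV.measurableSet).2 h0] with x hx using hx
  have key : ∀ f : Lp ℝ 2 (volume.restrict V), |inner ℝ f (hF.toLp F)| ≤ C * ‖f‖ := by
    intro f
    have hf : f ∈ closure (S : Set (Lp ℝ 2 (volume.restrict V))) := by
      rw [← Submodule.topologicalClosure_coe, hdense]; trivial
    refine closure_minimal (s := (S : Set (Lp ℝ 2 (volume.restrict V))))
      (t := {f | |inner ℝ f (hF.toLp F)| ≤ C * ‖f‖}) ?_ ?_ hf
    · rintro f ⟨φ, hφ, e⟩
      have h1 := h φ hφ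
      rw [Set.mem_ofPred_eq, inner_eq f _ φ F hφ e hF.coeFn_toLp]
      have h2 : ‖f‖ = l2 φ := by
        rw [Lp.norm_def, eLpNorm_congr_ae e, l2]
        congr 1
        rw [← eLpNorm_indicator_eq_eLpNorm_restrict hV.measurableSet,
          Set.indicator_eq_self.2 ((subset_tsupport φ).trans hφ.tsupport_subset)]
      rwa [h2]
    · exact isClosed_le (by fun_prop) (by fun_prop)
  have h1 := key (hF.toLp F)
  rw [real_inner_self_eq_norm_sq, abs_of_nonneg (by positivity), pow_two] at h1
  rw [← Lp.enorm_toLp hF]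
  rw [← ofReal_norm]
  apply ENNReal.ofReal_le_ofReal
  rcases (norm_nonneg (hF.toLp F)).eq_or_lt with h0 | h0
  · rwa [← h0]
  · exact le_of_mul_le_mul_right h1 h0

/-! ### Correlations with test functions -/

/-- The correlation `h ↦ ∫ φ(x) f(x + h) dx`.  For a test function `φ` it is a smooth function
of `h`, however rough `f` is, so that finite differences of `f`, tested with `φ`, are finite
differences of a smooth function. -/
noncomputable def corr (φ f : E d → ℝ) (h : E d) : ℝ := ∫ x, φ x * f (x + h)

lemma corr_eq (φ f : E d → ℝ) (h : E d) : corr φ f h = ∫ x, φ (x - h) * f x := by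
  rw [corr, ← integral_add_right_eq_self (fun x => φ (x - h) * f x) h]
  simp

lemma memLp_translate {f : E d → ℝ} (hf : MemLp f 2 volume) (a : E d) :
    MemLp (fun x => f (x + a)) 2 volume :=
  hf.comp_measurePreserving (measurePreserving_add_right volume a)

lemma eLpNorm_translate {f : E d → ℝ} (hf : AEStronglyMeasurable f volume) (a : E d) :
    eLpNorm (fun x => f (x + a)) 2 volume = eLpNorm f 2 volume :=
  eLpNorm_comp_measurePreserving hf (measurePreserving_add_right volume a)

lemma IsTest.integrable_mul {V : Set (E d)} {φ f : E d → ℝ} (hφ : IsTest V φ)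
    (hf : MemLp f 2 volume) : Integrable (fun x => φ x * f x) :=
  hφ.memLp.integrable_mul hf

lemma IsTest.integrable_corr {V : Set (E d)} {φ f : E d → ℝ} (hφ : IsTest V φ)
    (hf : MemLp f 2 volume) (a : E d) : Integrable (fun x => φ x * f (x + a)) :=
  hφ.integrable_mul (memLp_translate hf a)

lemma IsTest.hasDerivAt_corr {V : Set (E d)} {φ f : E d → ℝ} (hφ : IsTest V φ)
    (hf : MemLp f 2 volume) (a v : E d) (t : ℝ) :
    HasDerivAt (fun t : ℝ => corr φ f (a + t • v))
      (-corr (fun x => fderiv ℝ φ x v) f (a + t • v)) t := by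
  set ψ : E d → ℝ := fun x => φ (-x) with hψ
  have hψc : HasCompactSupport ψ := hφ.hasCompactSupport.comp_homeomorph (Homeomorph.neg (E d))
  have hψd : ContDiff ℝ 1 ψ := (hφ.contDiff.comp contDiff_neg).of_le (by simp)
  have hloc : LocallyIntegrable f volume := hf.locallyIntegrable (by norm_num)
  have h1 := hψc.hasFDerivAt_convolution_right (ContinuousLinearMap.mul ℝ ℝ) hloc hψd (a + t • v)
  have h2 : HasDerivAt (fun t : ℝ => a + t • v) v t := by
    simpa using ((hasDerivAt_id t).smul_const v).const_add a
  have h3 := h1.comp_hasDerivAt t h2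
  have e1 : (convolution f ψ (ContinuousLinearMap.mul ℝ ℝ) volume) ∘ (fun t : ℝ => a + t • v)
      = fun t : ℝ => corr φ f (a + t • v) := by
    funext t
    simp only [Function.comp, convolution, corr_eq, hψ, ContinuousLinearMap.mul_apply']
    refine integral_congr_ae (.of_forall fun x => ?_)
    simp [mul_comm]
  rw [e1] at h3
  refine h3.congr_deriv ?_
  rw [convolution_precompR_apply _ hloc (hψc.fderiv ℝ) (hψd.continuous_fderiv one_ne_zero),
    corr_eq, convolution, ← integral_neg]
  refine integral_congr_ae (.of_forall fun x => ?_)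
  have h4 : fderiv ℝ ψ = fun x => -fderiv ℝ φ (-x) := by
    funext x
    exact (((hφ.contDiff.differentiable (by simp) (-x)).hasFDerivAt.comp x
      (hasFDerivAt_id x).neg).fderiv).trans (by ext; simp)
  simp [h4, mul_comm]

/-! ### Finite differences of functions with weak derivatives -/

/-- The second difference `f(x + h) + f(x - h) - 2 f(x)`. -/
def secDiff (f : E d → ℝ) (h x : E d) : ℝ := f (x + h) + f (x + -h) - 2 * f x

/-- The mixed second difference `f(x + z + w) - f(x + z - w) - f(x - z + w) + f(x - z - w)`. -/
def mixDiff (f : E d → ℝ) (z w x : E d) : ℝ :=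
  f (x + (z + w)) - f (x + (z - w)) - f (x + (w - z)) + f (x + -(z + w))

section Calculus

lemma abs_sub_le_of_hasDerivAt {p p' : ℝ → ℝ} {C a b : ℝ} (hab : a ≤ b)
    (h : ∀ t, HasDerivAt p (p' t) t) (hC : ∀ t ∈ Set.Icc a b, |p' t| ≤ C) :
    |p b - p a| ≤ C * (b - a) :=
  norm_image_sub_le_of_norm_deriv_le_segment' (fun x _ => (h x).hasDerivWithinAt)
    (fun x hx => hC x ⟨hx.1, hx.2.le⟩) b ⟨hab, le_rfl⟩

lemma abs_mixed_le_of_hasDerivAt {P P₁ P₂ : ℝ → ℝ → ℝ} {C : ℝ}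
    (h1 : ∀ s t, HasDerivAt (fun s => P s t) (P₁ s t) s)
    (h2 : ∀ s t, HasDerivAt (fun t => P₁ s t) (P₂ s t) t)
    (hC : ∀ s ∈ Set.Icc (-1 : ℝ) 1, ∀ t ∈ Set.Icc (-1 : ℝ) 1, |P₂ s t| ≤ C) :
    |P 1 1 - P 1 (-1) - P (-1) 1 + P (-1) (-1)| ≤ 4 * C := by
  have := abs_sub_le_of_hasDerivAt (p := fun s => P s 1 - P s (-1)) (C := C * (1 - -1))
    (a := -1) (b := 1) (by norm_num) (fun s => (h1 s 1).sub (h1 s (-1)))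
    (fun s hs => abs_sub_le_of_hasDerivAt (by norm_num) (h2 s) (hC s hs))
  convert this using 1
  · congr 1; ring
  · ring

end Calculus

section Corr

variable {U V : Set (E d)} {φ f G : E d → ℝ}

lemma IsTest.abs_corr_le (hφ : IsTest V φ) (hf : MemLp f 2 volume) (a : E d) :
    |corr φ f a| ≤ (eLpNorm f 2 volume).toReal * l2 φ := by
  refine hφ.abs_integral_mul_le (memLp_translate hf a).1.restrict ENNReal.toReal_nonneg ?_
  rw [ENNReal.ofReal_toReal hf.2.ne, ← eLpNorm_translate hf.1 a]
  exact eLpNorm_mono_measure _ Measure.restrict_le_self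

/-- A weak directional derivative of `f` is the derivative of the correlations of `f`. -/
lemma IsTest.corr_fderiv (hφ : IsTest V φ) {v a : E d}
    (hw : ∀ ψ, IsTest U ψ → ∫ x, fderiv ℝ ψ x v * f x = -∫ x, ψ x * G x)
    (ha : ∀ x ∈ V, x + a ∈ U) :
    corr (fun x => fderiv ℝ φ x v) f a = -corr φ G a := by
  rw [corr_eq, corr_eq, ← hw _ (hφ.translate ha)]
  simp only [fderiv_comp_sub]

lemma IsTest.corr_fderiv_fderiv (hφ : IsTest V φ) {v w a : E d}
    (hw : ∀ ψ, IsTest U ψ →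
      ∫ x, fderiv ℝ (fun y => fderiv ℝ ψ y w) x v * f x = ∫ x, ψ x * G x)
    (ha : ∀ x ∈ V, x + a ∈ U) :
    corr (fun x => fderiv ℝ (fun y => fderiv ℝ φ y w) x v) f a = corr φ G a := by
  rw [corr_eq, corr_eq, ← hw _ (hφ.translate ha)]
  have e : ∀ x, fderiv ℝ (fun y => fderiv ℝ (fun x => φ (x - a)) y w) x v
      = fderiv ℝ (fun y => fderiv ℝ φ y w) (x - a) v := by
    intro x
    simp only [fderiv_comp_sub]
    exact congrArg (fun L : E d →L[ℝ] ℝ => L v) (fderiv_comp_sub (f := fun y => fderiv ℝ φ y w) a)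
  simp only [e]

lemma corr_zero (φ f : E d → ℝ) : corr φ f 0 = ∫ x, φ x * f x := by simp [corr]

lemma memLp_sub_translate (hf : MemLp f 2 volume) (v : E d) :
    MemLp (fun x => f (x + v) - f x) 2 volume := (memLp_translate hf v).sub hf

lemma memLp_secDiff (hf : MemLp f 2 volume) (v : E d) : MemLp (secDiff f v) 2 volume :=
  ((memLp_translate hf v).add (memLp_translate hf (-v))).sub (hf.const_mul 2)

lemma memLp_mixDiff (hf : MemLp f 2 volume) (z w : E d) : MemLp (mixDiff f z w) 2 volume :=
  (((memLp_translate hf _).sub (memLp_translate hf _)).sub (memLp_translate hf _)).add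
    (memLp_translate hf _)

lemma IsTest.integral_mul_secDiff (hφ : IsTest V φ) (hf : MemLp f 2 volume) (v : E d) :
    ∫ x, φ x * secDiff f v x = corr φ f v + corr φ f (-v) - 2 * corr φ f 0 := by
  have i := fun a => hφ.integrable_corr hf a
  have e : ∀ x, φ x * secDiff f v x = φ x * f (x + v) + φ x * f (x + -v) - 2 * (φ x * f x) :=
    fun x => by simp only [secDiff]; ring
  simp only [e]
  rw [integral_sub, integral_add (i _) (i _), integral_const_mul, corr_zero, corr, corr]
  · exact (i _).add (i _)
  · exact (hφ.integrable_mul hf).const_mul 2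

lemma IsTest.integral_mul_mixDiff (hφ : IsTest V φ) (hf : MemLp f 2 volume) (z w : E d) :
    ∫ x, φ x * mixDiff f z w x = corr φ f (z + w) - corr φ f (z - w) - corr φ f (w - z)
      + corr φ f (-(z + w)) := by
  have i := fun a => hφ.integrable_corr hf a
  have e : ∀ x, φ x * mixDiff f z w x = φ x * f (x + (z + w)) - φ x * f (x + (z - w))
      - φ x * f (x + (w - z)) + φ x * f (x + -(z + w)) :=
    fun x => by simp only [mixDiff]; ring
  simp only [e]
  rw [integral_add, integral_sub, integral_sub (i _) (i _), corr, corr, corr, corr]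
  · exact (i _).sub (i _)
  · exact i _
  · exact ((i _).sub (i _)).sub (i _)
  · exact i _

lemma eLpNorm_sub_translate_le (hV : IsOpen V) (hf : MemLp f 2 volume) (hG : MemLp G 2 volume)
    {v : E d} (hw : ∀ ψ, IsTest U ψ → ∫ x, fderiv ℝ ψ x v * f x = -∫ x, ψ x * G x)
    (hVU : ∀ x ∈ V, ∀ t ∈ Set.Icc (0 : ℝ) 1, x + t • v ∈ U) :
    eLpNorm (fun x => f (x + v) - f x) 2 (volume.restrict V) ≤ eLpNorm G 2 volume := by
  rw [← ENNReal.ofReal_toReal hG.2.ne]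
  refine eLpNorm_le_of_forall_test hV ((memLp_sub_translate hf v).restrict V)
    ENNReal.toReal_nonneg fun φ hφ => ?_
  have h := abs_sub_le_of_hasDerivAt zero_le_one (fun t => hφ.hasDerivAt_corr hf 0 v t)
    (C := (eLpNorm G 2 volume).toReal * l2 φ) (fun t ht => by
      rw [hφ.corr_fderiv hw (fun x hx => by simpa using hVU x hx t ht), neg_neg]
      exact hφ.abs_corr_le hG _)
  simp only [zero_add, one_smul, zero_smul, sub_zero, mul_one] at h
  rw [corr, corr_zero, ← integral_sub (hφ.integrable_corr hf v) (hφ.integrable_mul hf)] at h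
  simpa only [mul_sub] using h

lemma eLpNorm_secDiff_le_of_first (hV : IsOpen V) (hf : MemLp f 2 volume) (hG : MemLp G 2 volume)
    {v : E d} (hw : ∀ ψ, IsTest U ψ → ∫ x, fderiv ℝ ψ x v * f x = -∫ x, ψ x * G x)
    (hVU : ∀ x ∈ V, ∀ t ∈ Set.Icc (-1 : ℝ) 1, x + t • v ∈ U) {C : ℝ} (hC : 0 ≤ C)
    (h : ∀ t ∈ Set.Icc (0 : ℝ) 1,
      eLpNorm (fun x => G (x + t • v) - G (x + -(t • v))) 2 (volume.restrict V)
        ≤ ENNReal.ofReal C) :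
    eLpNorm (secDiff f v) 2 (volume.restrict V) ≤ ENNReal.ofReal C := by
  refine eLpNorm_le_of_forall_test hV ((memLp_secDiff hf v).restrict V) hC fun φ hφ => ?_
  have hneg : ∀ t : ℝ, HasDerivAt (fun t : ℝ => corr φ f (0 + (-t) • v))
      (corr (fun x => fderiv ℝ φ x v) f (0 + (-t) • v)) t := by
    intro t
    exact ((hφ.hasDerivAt_corr hf 0 v (-t)).comp t (hasDerivAt_neg t)).congr_deriv (by simp)
  have h1 := abs_sub_le_of_hasDerivAt zero_le_one
    (fun t => (hφ.hasDerivAt_corr hf 0 v t).add (hneg t)) (C := C * l2 φ) (fun t ht => by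
      rw [hφ.corr_fderiv hw (fun x hx => by
          simpa using hVU x hx t ⟨by linarith [ht.1], ht.2⟩),
        hφ.corr_fderiv hw (fun x hx => by
          simpa using hVU x hx (-t) ⟨by linarith [ht.2], by linarith [ht.1]⟩), neg_neg,
        ← sub_eq_add_neg, corr, corr,
        ← integral_sub (hφ.integrable_corr hG _) (hφ.integrable_corr hG _)]
      simp only [← mul_sub, zero_add, neg_smul]
      exact hφ.abs_integral_mul_le (((memLp_translate hG _).sub (memLp_translate hG _)).1.restrict)
        hC (h t ht))
  rw [hφ.integral_mul_secDiff hf]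
  simp only [Pi.add_apply, zero_add, one_smul, neg_smul, neg_zero, zero_smul, sub_zero,
    mul_one] at h1
  rwa [two_mul]

/-- The second-order Taylor estimate for mixed differences: after testing, both sides are evaluated
on the smooth function `(s, t) ↦ Ψ(s z + t w) + Ψ(- s z - t w)`, and the second differences of `G`
enter because `mixDiff` is invariant under `(z, w) ↦ (-z, -w)`. -/
lemma eLpNorm_mixDiff_sub_le (hV : IsOpen V) (hf : MemLp f 2 volume) (hG : MemLp G 2 volume)
    {z w : E d} (hw : ∀ ψ, IsTest U ψ →
      ∫ x, fderiv ℝ (fun y => fderiv ℝ ψ y z) x w * f x = ∫ x, ψ x * G x)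
    (hVU : ∀ x ∈ V, ∀ s ∈ Set.Icc (-1 : ℝ) 1, ∀ t ∈ Set.Icc (-1 : ℝ) 1, x + (s • z + t • w) ∈ U)
    {C : ℝ} (hC : 0 ≤ C)
    (h : ∀ s ∈ Set.Icc (-1 : ℝ) 1, ∀ t ∈ Set.Icc (-1 : ℝ) 1,
      eLpNorm (secDiff G (s • z + t • w)) 2 (volume.restrict V) ≤ ENNReal.ofReal C) :
    eLpNorm (fun x => mixDiff f z w x - 4 * G x) 2 (volume.restrict V)
      ≤ ENNReal.ofReal (2 * C) := by
  refine eLpNorm_le_of_forall_test (F := fun x => mixDiff f z w x - 4 * G x) hV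
    (((memLp_mixDiff hf z w).sub (hG.const_mul 4)).restrict V)
    (by positivity) fun φ hφ => ?_
  set Ψ := corr φ f with hΨ
  set Ψ₁ := corr (fun x => fderiv ℝ φ x z) f with hΨ₁
  set Ψ₂ := corr (fun x => fderiv ℝ (fun y => fderiv ℝ φ y z) x w) f with hΨ₂
  set D := corr φ G 0 with hD
  have h1 : ∀ a t, HasDerivAt (fun t : ℝ => Ψ (a + t • z)) (-Ψ₁ (a + t • z)) t :=
    fun a t => hφ.hasDerivAt_corr hf a z t
  have h2 : ∀ a t, HasDerivAt (fun t : ℝ => Ψ₁ (a + t • w)) (-Ψ₂ (a + t • w)) t :=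
    fun a t => (hφ.fderiv_apply z).hasDerivAt_corr hf a w t
  have h1' : ∀ a t, HasDerivAt (fun t : ℝ => Ψ (a + (-t) • z)) (Ψ₁ (a + (-t) • z)) t := by
    intro a t
    exact ((h1 a (-t)).comp t (hasDerivAt_neg t)).congr_deriv (by simp)
  have h2' : ∀ a t, HasDerivAt (fun t : ℝ => Ψ₁ (a + (-t) • w)) (Ψ₂ (a + (-t) • w)) t := by
    intro a t
    exact ((h2 a (-t)).comp t (hasDerivAt_neg t)).congr_deriv (by simp)
  have key := abs_mixed_le_of_hasDerivAt
    (P := fun s t => Ψ (t • w + s • z) + Ψ ((-t) • w + (-s) • z) - 2 * D * t * s)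
    (P₁ := fun s t => -Ψ₁ (s • z + t • w) + Ψ₁ ((-s) • z + (-t) • w) - 2 * D * t)
    (P₂ := fun s t => Ψ₂ (s • z + t • w) + Ψ₂ ((-s) • z + (-t) • w) - 2 * D) (C := C * l2 φ)
    (fun s t => by
      have := ((h1 (t • w) s).add (h1' ((-t) • w) s)).sub
        ((hasDerivAt_id s).const_mul (2 * D * t))
      rw [add_comm (s • z), add_comm ((-s) • z)]
      exact this.congr_deriv (by ring))
    (fun s t => by
      have := (((h2 (s • z) t).neg).add (h2' ((-s) • z) t)).sub
        ((hasDerivAt_id t).const_mul (2 * D))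
      exact this.congr_deriv (by ring))
    (fun s hs t ht => by
      have hs' : -s ∈ Set.Icc (-1 : ℝ) 1 := ⟨by linarith [hs.2], by linarith [hs.1]⟩
      have ht' : -t ∈ Set.Icc (-1 : ℝ) 1 := ⟨by linarith [ht.2], by linarith [ht.1]⟩
      simp only [hΨ₂]
      rw [hφ.corr_fderiv_fderiv hw (fun x hx => hVU x hx s hs t ht),
        hφ.corr_fderiv_fderiv hw (fun x hx => hVU x hx (-s) hs' (-t) ht')]
      have e : (-s) • z + (-t) • w = -(s • z + t • w) := by simp; abel
      rw [e, hD, ← hφ.integral_mul_secDiff hG]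
      exact hφ.abs_integral_mul_le (memLp_secDiff hG _).1.restrict hC (h s hs t ht))
  have e : ∫ x, φ x * (mixDiff f z w x - 4 * G x)
      = Ψ (z + w) - Ψ (z - w) - Ψ (w - z) + Ψ (-(z + w)) - 4 * D := by
    rw [hΨ, ← hφ.integral_mul_mixDiff hf, hD, corr_zero, ← integral_const_mul,
      ← integral_sub (hφ.integrable_mul (memLp_mixDiff hf z w))
        ((hφ.integrable_mul hG).const_mul 4)]
    simp only [mul_sub, mul_left_comm]
  rw [e]
  simp only [one_smul, neg_smul, neg_neg] at key
  rw [show w + z = z + w by abel, show -w + z = z - w by abel, show -w + -z = -(z + w) by abel,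
    show w + -z = w - z by abel] at key
  rw [abs_le] at key ⊢
  constructor <;> linarith [key.1, key.2]

lemma eLpNorm_mixDiff_le (hV : IsOpen V) (hf : MemLp f 2 volume) (hG : MemLp G 2 volume)
    {z w : E d} (hw : ∀ ψ, IsTest U ψ →
      ∫ x, fderiv ℝ (fun y => fderiv ℝ ψ y z) x w * f x = ∫ x, ψ x * G x)
    (hVU : ∀ x ∈ V, ∀ s ∈ Set.Icc (-1 : ℝ) 1, ∀ t ∈ Set.Icc (-1 : ℝ) 1, x + (s • z + t • w) ∈ U) :
    eLpNorm (mixDiff f z w) 2 (volume.restrict V) ≤ 4 * eLpNorm G 2 volume := by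
  have e0 : 4 * eLpNorm G 2 volume = ENNReal.ofReal (4 * (eLpNorm G 2 volume).toReal) := by
    rw [ENNReal.ofReal_mul (by norm_num), ENNReal.ofReal_toReal hG.2.ne]; simp
  rw [e0]
  refine eLpNorm_le_of_forall_test hV ((memLp_mixDiff hf z w).restrict V)
    (by positivity) fun φ hφ => ?_
  set Ψ := corr φ f with hΨ
  set Ψ₁ := corr (fun x => fderiv ℝ φ x z) f with hΨ₁
  set Ψ₂ := corr (fun x => fderiv ℝ (fun y => fderiv ℝ φ y z) x w) f with hΨ₂
  have key := abs_mixed_le_of_hasDerivAt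
    (P := fun s t => Ψ (t • w + s • z)) (P₁ := fun s t => -Ψ₁ (s • z + t • w))
    (P₂ := fun s t => Ψ₂ (s • z + t • w)) (C := (eLpNorm G 2 volume).toReal * l2 φ)
    (fun s t => by rw [add_comm (s • z)]; exact hφ.hasDerivAt_corr hf _ _ _)
    (fun s t => by
      have := ((hφ.fderiv_apply z).hasDerivAt_corr hf (s • z) w t).neg
      rwa [neg_neg] at this)
    (fun s hs t ht => by
      simp only [hΨ₂]
      rw [hφ.corr_fderiv_fderiv hw (fun x hx => hVU x hx s hs t ht)]
      exact hφ.abs_corr_le hG _)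
  rw [hφ.integral_mul_mixDiff hf]
  simp only [one_smul, neg_smul] at key
  rw [show w + z = z + w by abel, show -w + z = z - w by abel, show -w + -z = -(z + w) by abel,
    show w + -z = w - z by abel] at key
  linarith

end Corr

/-! ### Integrals of functions with values in `L²` -/

lemma eLpNorm_two_sq {X F : Type*} [MeasurableSpace X] [NormedAddCommGroup F] (ν : Measure X)
    (f : X → F) : eLpNorm f 2 ν ^ 2 = ∫⁻ x, ‖f x‖ₑ ^ 2 ∂ν := by
  have := eLpNorm_nnreal_pow_eq_lintegral (μ := ν) (f := f) (p := 2) two_ne_zero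
  simpa using this

section Minkowski

variable {P X : Type*} [MeasurableSpace P] [MeasurableSpace X]

lemma lintegral_mul_sq_le {μ : Measure P} {k a : P → ℝ≥0∞} (hk : Measurable k)
    (ha : Measurable a) :
    (∫⁻ p, k p * a p ∂μ) ^ 2 ≤ (∫⁻ p, k p ∂μ) * ∫⁻ p, k p * a p ^ 2 ∂μ := by
  have h := ENNReal.lintegral_mul_le_Lp_mul_Lq μ Real.HolderConjugate.two_two
    (f := fun p => k p ^ (1 / 2 : ℝ)) (g := fun p => k p ^ (1 / 2 : ℝ) * a p)
    (hk.pow_const _).aemeasurable ((hk.pow_const _).mul ha).aemeasurable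
  have e1 : ∀ p, k p ^ (1 / 2 : ℝ) * k p ^ (1 / 2 : ℝ) = k p := fun p => by
    rw [← ENNReal.rpow_add_of_nonneg _ _ (by norm_num) (by norm_num)]; norm_num
  have e2 : ∀ p, (k p ^ (1 / 2 : ℝ)) ^ (2 : ℝ) = k p := fun p => by
    rw [← ENNReal.rpow_mul]; norm_num
  have e3 : ∀ x : ℝ≥0∞, (x ^ (1 / 2 : ℝ)) ^ 2 = x := fun x => by
    rw [← ENNReal.rpow_natCast, ← ENNReal.rpow_mul]; norm_num
  have e4 : ∀ p, (k p ^ (1 / 2 : ℝ) * a p) ^ (2 : ℝ) = k p * a p ^ 2 := fun p => by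
    rw [ENNReal.mul_rpow_of_nonneg _ _ (by norm_num), e2, ENNReal.rpow_two]
  simp only [Pi.mul_apply, ← mul_assoc, e1, e2, e4] at h
  calc _ ≤ _ := pow_le_pow_left' h 2
    _ = _ := by rw [mul_pow, e3, e3]

/-- Minkowski's integral inequality in `L²`, for a family `b p` of functions with
`‖b p‖ ≤ c N(p)` that is integrated against a density `κ`. -/
lemma eLpNorm_integral_le {μ : Measure P} [SFinite μ] {ν : Measure X} [SFinite ν]
    {κ N : P → ℝ} {b : P → X → ℝ} {c : ℝ} (hκ : Measurable κ) (hN : Measurable N)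
    (hb : Measurable (Function.uncurry b)) (hκN : Integrable (fun p => κ p * N p) μ)
    (hN0 : ∀ p, 0 ≤ N p) (hb0 : ∀ p x, N p = 0 → b p x = 0) (hc : 0 ≤ c)
    (hbd : ∀ᵐ p ∂μ, κ p ≠ 0 → eLpNorm (b p) 2 ν ≤ ENNReal.ofReal (c * N p)) :
    (∀ᵐ x ∂ν, Integrable (fun p => κ p * b p x) μ) ∧
      eLpNorm (fun x => ∫ p, κ p * b p x ∂μ) 2 ν ≤
        ENNReal.ofReal (c * ∫ p, |κ p| * N p ∂μ) := by
  set k : P → ℝ≥0∞ := fun p => ‖κ p * N p‖ₑ with hk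
  set a : P → X → ℝ≥0∞ := fun p x => ‖b p x / N p‖ₑ with ha
  have hkm : Measurable k := (hκ.mul hN).enorm
  have ham : Measurable (Function.uncurry a) :=
    (hb.div (hN.comp measurable_fst)).enorm
  have hka : ∀ p x, ‖κ p * b p x‖ₑ = k p * a p x := by
    intro p x
    simp only [hk, ha]
    rw [← enorm_mul]
    rcases eq_or_ne (N p) 0 with h0 | h0
    · simp [h0, hb0 p x h0]
    · congr 1; field_simp
  have hk1 : ∫⁻ p, k p ∂μ = ENNReal.ofReal (∫ p, |κ p| * N p ∂μ) := by
    rw [ofReal_integral_eq_lintegral_ofReal]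
    · refine lintegral_congr fun p => ?_
      simp only [hk]
      rw [← ofReal_norm, norm_mul, Real.norm_eq_abs, Real.norm_eq_abs, abs_of_nonneg (hN0 p)]
    · refine hκN.norm.congr (.of_forall fun p => ?_)
      simp [abs_of_nonneg (hN0 p)]
    · exact .of_forall fun p => mul_nonneg (abs_nonneg _) (hN0 p)
  have ha2 : ∀ᵐ p ∂μ, k p * ∫⁻ x, a p x ^ 2 ∂ν ≤ k p * ENNReal.ofReal c ^ 2 := by
    filter_upwards [hbd] with p hp
    rcases eq_or_ne (κ p) 0 with h0 | h0
    · simp [hk, h0]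
    rcases eq_or_ne (N p) 0 with h1 | h1
    · simp [hk, h1]
    have hpos : 0 < N p := lt_of_le_of_ne (hN0 p) (Ne.symm h1)
    gcongr
    have e : ∀ x, a p x ^ 2 = ‖(N p)⁻¹‖ₑ ^ 2 * ‖b p x‖ₑ ^ 2 := fun x => by
      simp only [ha]
      rw [div_eq_inv_mul, enorm_mul, mul_pow]
    simp only [e]
    rw [lintegral_const_mul' _ _ (by simp), ← eLpNorm_two_sq, ← mul_pow]
    gcongr
    calc _ ≤ ‖(N p)⁻¹‖ₑ * ENNReal.ofReal (c * N p) := by gcongr; exact hp h0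
      _ = _ := by
        rw [← ofReal_norm, ← ENNReal.ofReal_mul (norm_nonneg _), Real.norm_of_nonneg
          (inv_nonneg.2 hpos.le)]
        congr 1; field_simp
  have main : ∫⁻ x, (∫⁻ p, ‖κ p * b p x‖ₑ ∂μ) ^ 2 ∂ν
      ≤ ENNReal.ofReal (c * ∫ p, |κ p| * N p ∂μ) ^ 2 := by
    calc ∫⁻ x, (∫⁻ p, ‖κ p * b p x‖ₑ ∂μ) ^ 2 ∂ν
        ≤ ∫⁻ x, (∫⁻ p, k p ∂μ) * ∫⁻ p, k p * a p x ^ 2 ∂μ ∂ν := by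
          refine lintegral_mono fun x => ?_
          simp only [hka]
          exact lintegral_mul_sq_le hkm (ham.comp measurable_prodMk_right)
      _ = (∫⁻ p, k p ∂μ) * ∫⁻ p, k p * ∫⁻ x, a p x ^ 2 ∂ν ∂μ := by
          rw [lintegral_const_mul' _ _ (by rw [hk1]; exact ENNReal.ofReal_ne_top),
            lintegral_lintegral_swap]
          · congr 1
            refine lintegral_congr fun p => ?_
            rw [lintegral_const_mul' _ _ enorm_ne_top]
          · exact ((hkm.comp measurable_snd).mul
              ((ham.comp measurable_swap).pow_const 2)).aemeasurable
      _ ≤ (∫⁻ p, k p ∂μ) * ∫⁻ p, k p * ENNReal.ofReal c ^ 2 ∂μ := by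
          gcongr 1
          exact lintegral_mono_ae ha2
      _ = _ := by
          rw [lintegral_mul_const' _ _ (by simp), hk1, ENNReal.ofReal_mul hc]; ring
  refine ⟨?_, ?_⟩
  · have hm : Measurable fun x => (∫⁻ p, ‖κ p * b p x‖ₑ ∂μ) ^ 2 := by
      refine (Measurable.lintegral_prod_left' (f := fun q : P × X => ‖κ q.1 * b q.1 q.2‖ₑ)
        ?_).pow_const 2
      exact ((hκ.comp measurable_fst).mul hb).enorm
    have := ae_lt_top hm (main.trans_lt (by simp)).ne
    filter_upwards [this] with x hx
    exact ⟨(hκ.mul (hb.comp measurable_prodMk_right)).aestronglyMeasurable,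
      hasFiniteIntegral_iff_enorm.2 (by
        simpa only [ENNReal.pow_lt_top_iff, two_ne_zero, or_false] using hx)⟩
  · rw [← ENNReal.pow_le_pow_left_iff two_ne_zero, eLpNorm_two_sq]
    refine le_trans (lintegral_mono fun x => ?_) main
    gcongr
    exact enorm_integral_le_lintegral_enorm _

end Minkowski

/-! ### Moduli of continuity in `L²` -/

section Modulus

variable {U V : Set (E d)} {f : E d → ℝ}

lemma eLpNorm_secDiff_le (hf : MemLp f 2 volume) (h : E d) :
    eLpNorm (secDiff f h) 2 (volume.restrict V) ≤
      eLpNorm (fun x => f (x + h) - f x) 2 (volume.restrict V) +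
        eLpNorm (fun x => f (x + -h) - f x) 2 (volume.restrict V) := by
  have e : secDiff f h = (fun x => f (x + h) - f x) + fun x => f (x + -h) - f x := by
    funext x; simp only [secDiff, Pi.add_apply]; ring
  rw [e]
  exact eLpNorm_add_le (memLp_sub_translate hf h).1.restrict
    (memLp_sub_translate hf (-h)).1.restrict (by norm_num)

/-- Translation is continuous in `L²`. -/
lemma exists_eLpNorm_sub_translate_le (hf : MemLp f 2 volume) {ε : ℝ} (hε : 0 < ε) :
    ∃ ρ > 0, ∀ h : E d, ‖h‖ < ρ →
      eLpNorm (fun x => f (x + h) - f x) 2 volume ≤ ENNReal.ofReal ε := by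
  have : Fact ((2 : ℝ≥0∞) ≠ ⊤) := ⟨by norm_num⟩
  have hc : Continuous fun h : E d => DomAddAct.mk h +ᵥ hf.toLp f := by
    have : Continuous (DomAddAct.mk : E d → (E d)ᵈᵃᵃ) := DomAddAct.continuous_mk
    exact this.vadd continuous_const
  have h0 := (hc.tendsto 0).eventually (Metric.ball_mem_nhds _ hε)
  obtain ⟨ρ, hρ, h1⟩ := Metric.eventually_nhds_iff.1 h0
  refine ⟨ρ, hρ, fun h hh => ?_⟩
  have h2 := (h1 (y := h) (by simpa using hh))
  rw [DomAddAct.mk_zero, zero_vadd, dist_eq_norm, DomAddAct.mk_vadd_toLp, ← MemLp.toLp_sub] at h2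
  have h3 : (fun x => f (x + h) - f x) = (fun x => f (h +ᵥ x)) - f := by
    funext x; simp [add_comm]
  rw [h3, ← Lp.enorm_toLp, ← ofReal_norm]
  · exact ENNReal.ofReal_le_ofReal h2.le
  · rw [← h3]; exact memLp_sub_translate hf h

/-- The Gagliardo integral of a scalar function. -/
noncomputable def gagliardo (U : Set (E d)) (r : ℝ) (f : E d → ℝ) : ℝ≥0∞ :=
  ∫⁻ x in U, ∫⁻ y in U, ENNReal.ofReal ((f y - f x) ^ 2 / ‖y - x‖ ^ ((d : ℝ) + 2 * r))

/-- The constant `4 · 2ᵈ / |B₁|` in the bound of the `L²` modulus of continuity by the Gagliardo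
integral. -/
noncomputable def gagliardoConst (d : ℕ) : ℝ :=
  4 * 2 ^ d / (volume (Metric.ball (0 : E d) 1)).toReal

/-- The embedding of `W^{r,2}` into the Nikolskii space of order `r`: the difference
`f(x + h) - f(x)` is the sum of `f(x + h) - f(x + y)` and `f(x + y) - f(x)`; average over the `y`
in the ball with diameter `[0, h]`, for which both increments have length at most `|h|`. -/
lemma eLpNorm_sub_translate_sq_le (hd : 0 < d) (hUm : MeasurableSet U) (hVm : MeasurableSet V)
    (hf : Measurable f) {r : ℝ} (hr : 0 ≤ r) {h : E d}
    (hVU : ∀ x ∈ V, ∀ y : E d, ‖y‖ ≤ ‖h‖ → x + y ∈ U) :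
    eLpNorm (fun x => f (x + h) - f x) 2 (volume.restrict V) ^ 2 ≤
      ENNReal.ofReal (gagliardoConst d * ‖h‖ ^ (2 * r)) * gagliardo U r f := by
  have : Nonempty (Fin d) := ⟨⟨0, hd⟩⟩
  rcases eq_or_ne h 0 with rfl | hh
  · simp
  have hh0 : 0 < ‖h‖ := norm_pos_iff.2 hh
  set p : ℝ := (d : ℝ) + 2 * r with hp
  have hp0 : 0 ≤ p := by positivity
  set k : E d → E d → ℝ≥0∞ := fun x y => ENNReal.ofReal ((f y - f x) ^ 2 / ‖y - x‖ ^ p) with hk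
  have hkm : Measurable (Function.uncurry k) := by
    simp only [hk, Function.uncurry_def]
    fun_prop
  set B := Metric.ball ((2 : ℝ)⁻¹ • h) (‖h‖ / 2) with hB
  have hB1 : ∀ y ∈ B, ‖y‖ ≤ ‖h‖ ∧ ‖h - y‖ ≤ ‖h‖ := by
    intro y hy
    rw [hB, mem_ball_iff_norm] at hy
    have e : ‖(2 : ℝ)⁻¹ • h‖ = ‖h‖ / 2 := by rw [norm_smul]; norm_num; ring
    constructor
    · calc ‖y‖ = ‖(y - (2 : ℝ)⁻¹ • h) + (2 : ℝ)⁻¹ • h‖ := by simp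
        _ ≤ _ := norm_add_le _ _
        _ ≤ ‖h‖ := by linarith
    · calc ‖h - y‖ = ‖(2 : ℝ)⁻¹ • h - (y - (2 : ℝ)⁻¹ • h)‖ := by
            congr 1
            have : h = (2 : ℝ)⁻¹ • h + (2 : ℝ)⁻¹ • h := by rw [← add_smul]; norm_num
            nth_rewrite 1 [this]; abel
        _ ≤ _ := norm_sub_le _ _
        _ ≤ ‖h‖ := by linarith
  have hkle : ∀ x y : E d, ‖y - x‖ ≤ ‖h‖ →
      ENNReal.ofReal ((f y - f x) ^ 2) ≤ ENNReal.ofReal (‖h‖ ^ p) * k x y := by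
    intro x y hxy
    rw [hk, ← ENNReal.ofReal_mul (by positivity)]
    apply ENNReal.ofReal_le_ofReal
    rcases eq_or_ne y x with rfl | hne
    · simp
    · have h1 : 0 < ‖y - x‖ := norm_pos_iff.2 (sub_ne_zero.2 hne)
      rw [mul_div_assoc', le_div_iff₀ (by positivity), mul_comm]
      gcongr
  have hpt : ∀ x, ∀ y ∈ B, ‖f (x + h) - f x‖ₑ ^ 2 ≤
      ENNReal.ofReal (2 * ‖h‖ ^ p) * (k x (x + y) + k (x + h) (x + y)) := by
    intro x y hy
    have h1 := hkle x (x + y) (by simpa using (hB1 y hy).1)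
    have h2 := hkle (x + h) (x + y) (by
      rw [add_sub_add_left_eq_sub, norm_sub_rev]; exact (hB1 y hy).2)
    calc ‖f (x + h) - f x‖ₑ ^ 2 = ENNReal.ofReal ((f (x + h) - f x) ^ 2) := by
          rw [← ofReal_norm, ← ENNReal.ofReal_pow (norm_nonneg _), Real.norm_eq_abs, sq_abs]
      _ ≤ ENNReal.ofReal (2 * ((f (x + y) - f x) ^ 2 + (f (x + y) - f (x + h)) ^ 2)) := by
          apply ENNReal.ofReal_le_ofReal
          nlinarith [sq_nonneg ((f (x + y) - f x) + (f (x + y) - f (x + h)))]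
      _ = 2 * (ENNReal.ofReal ((f (x + y) - f x) ^ 2)
            + ENNReal.ofReal ((f (x + y) - f (x + h)) ^ 2)) := by
          rw [ENNReal.ofReal_mul (by norm_num), ENNReal.ofReal_add (by positivity) (by positivity)]
          simp
      _ ≤ 2 * (ENNReal.ofReal (‖h‖ ^ p) * k x (x + y)
            + ENNReal.ofReal (‖h‖ ^ p) * k (x + h) (x + y)) := by gcongr
      _ = _ := by rw [ENNReal.ofReal_mul (by norm_num)]; simp; ring
  -- the inner integrals, for a base point `x ∈ V` and `z ∈ U`
  have hin : ∀ x ∈ V, ∀ z, ∫⁻ y in B, k z (x + y) ≤ ∫⁻ y in U, k z y := by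
    intro x hx z
    rw [← lintegral_indicator Metric.isOpen_ball.measurableSet, ← lintegral_indicator hUm,
      ← lintegral_add_left_eq_self (fun y => U.indicator (fun y => k z y) y) x]
    refine lintegral_mono fun y => ?_
    by_cases hy : y ∈ B
    · rw [Set.indicator_of_mem hy, Set.indicator_of_mem (hVU x hx y (hB1 y hy).1)]
    · rw [Set.indicator_of_notMem hy]; exact zero_le
  have hQm : Measurable fun x => ∫⁻ y in U, k x y := hkm.lintegral_prod_right'
  have hVsub : V ⊆ U := fun x hx => by simpa using hVU x hx 0 (by simp)
  have hout : ∫⁻ x in V, ∫⁻ y in U, k (x + h) y ≤ gagliardo U r f := by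
    rw [gagliardo, ← lintegral_indicator hVm, ← lintegral_indicator hUm,
      ← lintegral_add_right_eq_self
        (fun x => U.indicator (fun x => ∫⁻ y in U, k x y) x) h]
    refine lintegral_mono fun x => ?_
    by_cases hx : x ∈ V
    · rw [Set.indicator_of_mem hx, Set.indicator_of_mem (hVU x hx h le_rfl)]
    · rw [Set.indicator_of_notMem hx]; exact zero_le
  have hvol : volume B * eLpNorm (fun x => f (x + h) - f x) 2 (volume.restrict V) ^ 2 ≤
      ENNReal.ofReal (4 * ‖h‖ ^ p) * gagliardo U r f := by
    rw [eLpNorm_two_sq, ← lintegral_const_mul _ (by fun_prop)]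
    calc ∫⁻ x in V, volume B * ‖f (x + h) - f x‖ₑ ^ 2
        ≤ ∫⁻ x in V, ENNReal.ofReal (2 * ‖h‖ ^ p) *
            ((∫⁻ y in U, k x y) + ∫⁻ y in U, k (x + h) y) := by
          refine setLIntegral_mono' hVm fun x hx => ?_
          calc volume B * ‖f (x + h) - f x‖ₑ ^ 2 = ∫⁻ y in B, ‖f (x + h) - f x‖ₑ ^ 2 := by
                rw [setLIntegral_const, mul_comm]
            _ ≤ ∫⁻ y in B, ENNReal.ofReal (2 * ‖h‖ ^ p) * (k x (x + y) + k (x + h) (x + y)) :=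
                setLIntegral_mono' Metric.isOpen_ball.measurableSet (hpt x)
            _ = ENNReal.ofReal (2 * ‖h‖ ^ p) *
                  ((∫⁻ y in B, k x (x + y)) + ∫⁻ y in B, k (x + h) (x + y)) := by
                rw [lintegral_const_mul' _ _ ENNReal.ofReal_ne_top, lintegral_add_left]
                exact hkm.comp (f := fun y => (x, x + y)) (by fun_prop)
            _ ≤ _ := mul_le_mul_right (add_le_add (hin x hx x) (hin x hx (x + h))) _
      _ = ENNReal.ofReal (2 * ‖h‖ ^ p) *
            ((∫⁻ x in V, ∫⁻ y in U, k x y) + ∫⁻ x in V, ∫⁻ y in U, k (x + h) y) := by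
          rw [lintegral_const_mul' _ _ ENNReal.ofReal_ne_top, lintegral_add_left hQm]
      _ ≤ ENNReal.ofReal (2 * ‖h‖ ^ p) * (gagliardo U r f + gagliardo U r f) := by
          gcongr
          exact lintegral_mono_set hVsub
      _ = _ := by
          rw [show 4 * ‖h‖ ^ p = 2 * ‖h‖ ^ p + 2 * ‖h‖ ^ p by ring,
            ENNReal.ofReal_add (by positivity) (by positivity)]
          ring
  set β := (volume (Metric.ball (0 : E d) 1)).toReal with hβ
  have hβ0 : 0 < β := ENNReal.toReal_pos (Metric.measure_ball_pos _ _ one_pos).ne'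
    measure_ball_lt_top.ne
  have hBvol : volume B = ENNReal.ofReal ((‖h‖ / 2) ^ d * β) := by
    rw [hB, Measure.addHaar_ball _ _ (by positivity), ENNReal.ofReal_mul (by positivity), hβ,
      ENNReal.ofReal_toReal measure_ball_lt_top.ne]
    simp
  have hfin : ENNReal.ofReal (4 * ‖h‖ ^ p)
      = volume B * ENNReal.ofReal (gagliardoConst d * ‖h‖ ^ (2 * r)) := by
    rw [hBvol, ← ENNReal.ofReal_mul (by positivity), gagliardoConst, ← hβ, hp,
      Real.rpow_add hh0, Real.rpow_natCast]
    congr 1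
    rw [div_pow]
    field_simp
  rw [hfin, mul_assoc] at hvol
  refine (ENNReal.mul_le_mul_iff_right ?_ ?_).1 hvol
  · rw [hBvol]; simp; positivity
  · rw [hBvol]; exact ENNReal.ofReal_ne_top

end Modulus

/-! ### Partial derivatives and weak derivatives of scalar functions -/

lemma eq_sum_single (v : E d) : v = ∑ k, v k • EuclideanSpace.single k (1 : ℝ) := by
  ext i
  simp [Finset.sum_apply, Pi.single_apply]

lemma fderiv_eq_sum_partialDeriv (φ : E d → ℝ) (x v : E d) :
    fderiv ℝ φ x v = ∑ k, v k * partialDeriv ![k] φ x := by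
  conv_lhs => rw [eq_sum_single v]
  simp [partialDeriv]

lemma fderiv_fderiv_eq_sum_partialDeriv {φ : E d → ℝ} (hφ : ContDiff ℝ ∞ φ) (x v w : E d) :
    fderiv ℝ (fun y => fderiv ℝ φ y w) x v
      = ∑ i : Fin d × Fin d, v i.1 * w i.2 * partialDeriv ![i.1, i.2] φ x := by
  have h : DifferentiableAt ℝ (fderiv ℝ φ) x :=
    (hφ.fderiv_right (m := ∞) (by simp)).differentiable (by simp) x
  have e : fderiv ℝ (fun y => fderiv ℝ φ y w) x v = fderiv ℝ (fderiv ℝ φ) x v w := by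
    rw [fderiv_clm_apply h (differentiableAt_const w)]
    simp
  rw [e]
  conv_lhs => rw [eq_sum_single v, eq_sum_single w]
  simp only [map_sum, map_smul, _root_.sum_apply, _root_.smul_apply,
    smul_eq_mul, partialDeriv, iteratedFDeriv_two_apply, Fintype.sum_prod_type]
  rw [Finset.sum_comm]
  refine Finset.sum_congr rfl fun k _ => ?_
  rw [Finset.mul_sum]
  refine Finset.sum_congr rfl fun l _ => ?_
  simp; ring

lemma partialDeriv_snoc {φ : E d → ℝ} (hφ : ContDiff ℝ ∞ φ) {n : ℕ} (J : Fin n → Fin d)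
    (m : Fin d) :
    partialDeriv (Fin.snoc J m) φ = partialDeriv J (fun x => partialDeriv ![m] φ x) := by
  funext x
  simp only [partialDeriv, iteratedFDeriv_one_apply, iteratedFDeriv_succ_apply_right (n := n)]
  rw [iteratedFDeriv_clm_apply_const_apply (n := ∞) (hφ.fderiv_right (by simp))
    (by exact_mod_cast le_top)]
  have e : (Fin.init fun k => EuclideanSpace.single ((Fin.snoc J m : Fin (n + 1) → Fin d) k) (1 : ℝ))
      = fun k => EuclideanSpace.single (J k) (1 : ℝ) := by
    funext k; simp [Fin.init]
  rw [e]
  simp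

lemma IsTest.partialDeriv_one {U : Set (E d)} {φ : E d → ℝ} (hφ : IsTest U φ) (m : Fin d) :
    IsTest U (partialDeriv ![m] φ) := by
  have : partialDeriv ![m] φ = fun x => fderiv ℝ φ x (EuclideanSpace.single m 1) := by
    funext x; simp [partialDeriv]
  rw [this]
  exact hφ.fderiv_apply _

/-- `g` is the weak derivative `∂_J f` on `U`, for scalar functions on the whole space. -/
def IsWeakDeriv {n : ℕ} (U : Set (E d)) (J : Fin n → Fin d) (f g : E d → ℝ) : Prop :=
  ∀ φ, IsTest U φ → ∫ x, partialDeriv J φ x * f x = (-1 : ℝ) ^ n * ∫ x, φ x * g x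

namespace IsWeakDeriv

variable {U : Set (E d)} {f g p : E d → ℝ}

lemma third {k l m : Fin d} (h2 : IsWeakDeriv U ![k, l] f g) (h3 : IsWeakDeriv U ![k, l, m] f p) :
    IsWeakDeriv U ![m] g p := by
  intro φ hφ
  have e1 := h2 _ (hφ.partialDeriv_one m)
  have e2 := h3 _ hφ
  have e3 : (![k, l, m] : Fin 3 → Fin d) = Fin.snoc ![k, l] m := by
    ext i; fin_cases i <;> rfl
  rw [e3, partialDeriv_snoc hφ.contDiff] at e2
  linarith

lemma fourth {k l m n : Fin d} (h2 : IsWeakDeriv U ![k, l] f g)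
    (h4 : IsWeakDeriv U ![k, l, m, n] f p) : IsWeakDeriv U ![m, n] g p := by
  intro φ hφ
  have e1 := h2 _ ((hφ.partialDeriv_one n).partialDeriv_one m)
  have e2 := h4 _ hφ
  have e3 : (![k, l, m, n] : Fin 4 → Fin d) = Fin.snoc ![k, l, m] n := by
    ext i; fin_cases i <;> rfl
  have e4 : (![k, l, m] : Fin 3 → Fin d) = Fin.snoc ![k, l] m := by
    ext i; fin_cases i <;> rfl
  have e5 : (![m, n] : Fin 2 → Fin d) = Fin.snoc ![m] n := by
    ext i; fin_cases i <;> rfl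
  rw [e3, partialDeriv_snoc hφ.contDiff, e4,
    partialDeriv_snoc (hφ.partialDeriv_one n).contDiff] at e2
  rw [e5, partialDeriv_snoc hφ.contDiff]
  linarith

lemma integral_fderiv {g : Fin d → E d → ℝ} (hf : MemLp f 2 volume)
    (hg : ∀ k, MemLp (g k) 2 volume) (h : ∀ k, IsWeakDeriv U ![k] f (g k)) (v : E d)
    (ψ : E d → ℝ) (hψ : IsTest U ψ) :
    ∫ x, fderiv ℝ ψ x v * f x = -∫ x, ψ x * ∑ k, v k * g k x := by
  simp only [fderiv_eq_sum_partialDeriv, Finset.sum_mul, Finset.mul_sum, mul_assoc,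
    mul_left_comm (ψ _)]
  rw [integral_finsetSum, integral_finsetSum, ← Finset.sum_neg_distrib]
  · refine Finset.sum_congr rfl fun k _ => ?_
    rw [integral_const_mul, integral_const_mul, h k ψ hψ]; ring
  · exact fun k _ => (hψ.integrable_mul (hg k)).const_mul _
  · exact fun k _ => ((hψ.partialDeriv_one k).integrable_mul hf).const_mul _

lemma integral_fderiv_fderiv {g : Fin d → Fin d → E d → ℝ} (hf : MemLp f 2 volume)
    (hg : ∀ k l, MemLp (g k l) 2 volume) (h : ∀ k l, IsWeakDeriv U ![k, l] f (g k l)) (v w : E d)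
    (ψ : E d → ℝ) (hψ : IsTest U ψ) :
    ∫ x, fderiv ℝ (fun y => fderiv ℝ ψ y w) x v * f x
      = ∫ x, ψ x * ∑ i : Fin d × Fin d, v i.1 * w i.2 * g i.1 i.2 x := by
  simp only [fderiv_fderiv_eq_sum_partialDeriv hψ.contDiff, Finset.sum_mul, Finset.mul_sum,
    mul_left_comm (ψ _)]
  simp only [mul_assoc]
  rw [integral_finsetSum, integral_finsetSum]
  · refine Finset.sum_congr rfl fun i _ => ?_
    simp only [integral_const_mul]
    rw [h i.1 i.2 ψ hψ]; ring
  · exact fun i _ => ((hψ.integrable_mul (hg i.1 i.2)).const_mul _).const_mul _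
  · intro i _
    have e5 : (![i.1, i.2] : Fin 2 → Fin d) = Fin.snoc ![i.1] i.2 := by
      ext i; fin_cases i <;> rfl
    rw [e5, partialDeriv_snoc hψ.contDiff]
    exact ((((hψ.partialDeriv_one i.2).partialDeriv_one i.1).integrable_mul hf).const_mul
      _).const_mul _

end IsWeakDeriv

/-! ### Second differences of Sobolev functions -/

lemma eLpNorm_sum_mul_le {X ι : Type*} [MeasurableSpace X] {ν : Measure X} [Fintype ι]
    {c : ι → ℝ} {F : ι → X → ℝ} (hF : ∀ i, AEStronglyMeasurable (F i) ν) {b C : ℝ}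
    (hb : 0 ≤ b) (hc : ∀ i, |c i| ≤ b) (h : ∀ i, eLpNorm (F i) 2 ν ≤ ENNReal.ofReal C) :
    eLpNorm (fun x => ∑ i, c i * F i x) 2 ν ≤ ENNReal.ofReal (Fintype.card ι * (b * C)) := by
  have e : (fun x => ∑ i, c i * F i x) = ∑ i, fun x => c i * F i x := by
    funext x; simp
  rw [e]
  refine (eLpNorm_sum_le (fun i _ => (hF i).const_mul (c i)) (by norm_num)).trans ?_
  calc ∑ i, eLpNorm (fun x => c i * F i x) 2 ν ≤ ∑ _i : ι, ENNReal.ofReal (b * C) := by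
        refine Finset.sum_le_sum fun i _ => ?_
        have := eLpNorm_const_smul_le (c := c i) (f := F i) (p := 2) (μ := ν)
        refine this.trans ?_
        rw [ENNReal.ofReal_mul hb]
        gcongr
        · rw [← ofReal_norm]; exact ENNReal.ofReal_le_ofReal (hc i)
        · exact h i
    _ = _ := by
        rw [Finset.sum_const, Finset.card_univ, nsmul_eq_mul, ENNReal.ofReal_mul (Nat.cast_nonneg _),
          ENNReal.ofReal_natCast]

lemma abs_apply_le (v : E d) (k : Fin d) : |v k| ≤ ‖v‖ := PiLp.norm_apply_le v k

lemma mixDiff_comm (f : E d → ℝ) (z w : E d) : mixDiff f z w = mixDiff f w z := by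
  funext x
  simp only [mixDiff, add_comm z w]; ring

section Differences

variable {U V : Set (E d)} {f : E d → ℝ}

lemma smul_add_smul_norm_le {s t : ℝ} (hs : s ∈ Set.Icc (-1 : ℝ) 1) (ht : t ∈ Set.Icc (-1 : ℝ) 1)
    (z w : E d) : ‖s • z + t • w‖ ≤ ‖z‖ + ‖w‖ := by
  refine (norm_add_le _ _).trans (add_le_add ?_ ?_) <;> rw [norm_smul, Real.norm_eq_abs]
  · exact mul_le_of_le_one_left (norm_nonneg _) (abs_le.2 hs)
  · exact mul_le_of_le_one_left (norm_nonneg _) (abs_le.2 ht)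

/-- Taylor's formula for mixed differences: the error is controlled by the second differences of
the second derivatives, over increments of length at most `|z| + |w|`. -/
lemma eLpNorm_mixDiff_sub_sum_le (hV : IsOpen V) (hf : MemLp f 2 volume)
    {g : Fin d → Fin d → E d → ℝ} (hg : ∀ k l, MemLp (g k l) 2 volume)
    (hw : ∀ k l, IsWeakDeriv U ![k, l] f (g k l)) {ρ : ℝ}
    (hVU : ∀ x ∈ V, ∀ h : E d, ‖h‖ < ρ → x + h ∈ U) {η : ℝ} (hη : 0 ≤ η)
    (hmod : ∀ k l, ∀ h : E d, ‖h‖ < ρ →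
      eLpNorm (secDiff (g k l) h) 2 (volume.restrict V) ≤ ENNReal.ofReal η)
    {z w : E d} (hzw : ‖z‖ + ‖w‖ < ρ) :
    eLpNorm (fun x => mixDiff f z w x - 4 * ∑ i : Fin d × Fin d, z i.1 * w i.2 * g i.1 i.2 x) 2
      (volume.restrict V) ≤ ENNReal.ofReal (2 * (d * d * η) * (‖z‖ * ‖w‖)) := by
  have hG : MemLp (fun x => ∑ i : Fin d × Fin d, z i.1 * w i.2 * g i.1 i.2 x) 2 volume :=
    memLp_finsetSum _ fun i _ => (hg i.1 i.2).const_mul _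
  have hb : ∀ i : Fin d × Fin d, |z i.1 * w i.2| ≤ ‖z‖ * ‖w‖ := fun i => by
    rw [abs_mul]
    exact mul_le_mul (abs_apply_le _ _) (abs_apply_le _ _) (abs_nonneg _) (norm_nonneg _)
  rw [mixDiff_comm]
  refine (eLpNorm_mixDiff_sub_le (C := d * d * (‖z‖ * ‖w‖ * η)) hV hf hG
    (IsWeakDeriv.integral_fderiv_fderiv hf hg hw z w) ?_ (by positivity) ?_).trans
    (ENNReal.ofReal_le_ofReal (by linarith))
  · intro x hx s hs t ht
    exact hVU x hx _ ((smul_add_smul_norm_le hs ht w z).trans_lt (by linarith))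
  · intro s hs t ht
    set h := s • w + t • z with hh
    have hlt : ‖h‖ < ρ := (smul_add_smul_norm_le hs ht w z).trans_lt (by linarith)
    have e : secDiff (fun x => ∑ i : Fin d × Fin d, z i.1 * w i.2 * g i.1 i.2 x) h
        = fun x => ∑ i : Fin d × Fin d, z i.1 * w i.2 * secDiff (g i.1 i.2) h x := by
      funext x
      simp only [secDiff, mul_sub, mul_add, Finset.sum_sub_distrib, Finset.sum_add_distrib,
        Finset.mul_sum]
      congr 1
      exact Finset.sum_congr rfl fun i _ => by ring
    rw [e]
    have := eLpNorm_sum_mul_le (ν := volume.restrict V)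
      (c := fun i : Fin d × Fin d => z i.1 * w i.2) (F := fun i => secDiff (g i.1 i.2) h)
      (fun i => (memLp_secDiff (hg i.1 i.2) h).1.restrict) (by positivity) hb
      (fun i => hmod i.1 i.2 h hlt)
    simpa using this

/-- The first difference of a function with weak gradient in `L²`. -/
lemma eLpNorm_sub_translate_le_norm (hV : IsOpen V) (hf : MemLp f 2 volume)
    {g : Fin d → E d → ℝ} (hg : ∀ k, MemLp (g k) 2 volume)
    (hw : ∀ k, IsWeakDeriv U ![k] f (g k)) {ρ : ℝ}
    (hVU : ∀ x ∈ V, ∀ h : E d, ‖h‖ < ρ → x + h ∈ U) {C : ℝ}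
    (hC : ∀ k, eLpNorm (g k) 2 volume ≤ ENNReal.ofReal C) {v : E d} (hv : ‖v‖ < ρ) :
    eLpNorm (fun x => f (x + v) - f x) 2 (volume.restrict V) ≤
      ENNReal.ofReal (d * C * ‖v‖) := by
  have hG : MemLp (fun x => ∑ k, v k * g k x) 2 volume :=
    memLp_finsetSum _ fun i _ => (hg i).const_mul _
  refine (eLpNorm_sub_translate_le hV hf hG (IsWeakDeriv.integral_fderiv hf hg hw v) ?_).trans ?_
  · intro x hx t ht
    refine hVU x hx _ (lt_of_le_of_lt ?_ hv)
    rw [norm_smul, Real.norm_of_nonneg ht.1]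
    exact mul_le_of_le_one_left (norm_nonneg _) ht.2
  · refine (eLpNorm_sum_mul_le (fun i => (hg i).1) (norm_nonneg v) (abs_apply_le v) hC).trans ?_
    exact ENNReal.ofReal_le_ofReal (by rw [Fintype.card_fin]; linarith)

/-- The second difference of a function with weak gradient in `L²` is controlled by the first
differences of the gradient. -/
lemma eLpNorm_secDiff_le_of_gradient (hV : IsOpen V) (hf : MemLp f 2 volume)
    {g : Fin d → E d → ℝ} (hg : ∀ k, MemLp (g k) 2 volume)
    (hw : ∀ k, IsWeakDeriv U ![k] f (g k)) {v : E d}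
    (hVU : ∀ x ∈ V, ∀ h : E d, ‖h‖ ≤ ‖v‖ → x + h ∈ U) {C : ℝ} (hC0 : 0 ≤ C)
    (hC : ∀ k, ∀ h : E d, ‖h‖ ≤ ‖v‖ →
      eLpNorm (fun x => g k (x + h) - g k x) 2 (volume.restrict V) ≤ ENNReal.ofReal C) :
    eLpNorm (secDiff f v) 2 (volume.restrict V) ≤ ENNReal.ofReal (2 * d * C * ‖v‖) := by
  have hG : MemLp (fun x => ∑ k, v k * g k x) 2 volume :=
    memLp_finsetSum _ fun i _ => (hg i).const_mul _
  have hle : ∀ t ∈ Set.Icc (-1 : ℝ) 1, ‖t • v‖ ≤ ‖v‖ := fun t ht => by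
    rw [norm_smul, Real.norm_eq_abs]
    exact mul_le_of_le_one_left (norm_nonneg _) (abs_le.2 ht)
  refine eLpNorm_secDiff_le_of_first hV hf hG (IsWeakDeriv.integral_fderiv hf hg hw v)
    (fun x hx t ht => hVU x hx _ (hle t ht)) (by positivity) fun t ht => ?_
  have ht' : t ∈ Set.Icc (-1 : ℝ) 1 := ⟨by linarith [ht.1], ht.2⟩
  have e : (fun x => ∑ k, v k * g k (x + t • v) - ∑ k, v k * g k (x + -(t • v)))
      = fun x => ∑ k, v k * (g k (x + t • v) - g k (x + -(t • v))) := by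
    funext x
    rw [← Finset.sum_sub_distrib]
    exact Finset.sum_congr rfl fun k _ => by ring
  have h2 : ∀ k, eLpNorm (fun x => g k (x + t • v) - g k (x + -(t • v))) 2 (volume.restrict V)
      ≤ ENNReal.ofReal (2 * C) := by
    intro k
    have e' : (fun x => g k (x + t • v) - g k (x + -(t • v)))
        = (fun x => g k (x + t • v) - g k x) - fun x => g k (x + -(t • v)) - g k x := by
      funext x; simp
    rw [e']
    refine (eLpNorm_sub_le (memLp_sub_translate (hg k) _).1.restrict
      (memLp_sub_translate (hg k) _).1.restrict (by norm_num)).trans ?_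
    rw [two_mul, ENNReal.ofReal_add hC0 hC0]
    exact add_le_add (hC k _ (hle t ht')) (hC k _ (by rw [norm_neg]; exact hle t ht'))
  simp only [e]
  refine (eLpNorm_sum_mul_le (fun k => ((memLp_translate (hg k) _).sub
    (memLp_translate (hg k) _)).1.restrict) (norm_nonneg v) (abs_apply_le v) h2).trans ?_
  exact ENNReal.ofReal_le_ofReal (by rw [Fintype.card_fin]; linarith)

/-- The second difference of a function with weak Hessian in `L²`. -/
lemma eLpNorm_secDiff_le_of_hessian (hV : IsOpen V) (hf : MemLp f 2 volume)
    {g : Fin d → Fin d → E d → ℝ} (hg : ∀ k l, MemLp (g k l) 2 volume)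
    (hw : ∀ k l, IsWeakDeriv U ![k, l] f (g k l)) {v : E d}
    (hVU : ∀ x ∈ V, ∀ h : E d, ‖h‖ ≤ ‖v‖ → x + h ∈ U) {C : ℝ}
    (hC : ∀ k l, eLpNorm (g k l) 2 volume ≤ ENNReal.ofReal C) :
    eLpNorm (secDiff f v) 2 (volume.restrict V) ≤ ENNReal.ofReal (d * d * C * ‖v‖ ^ 2) := by
  set z : E d := (2 : ℝ)⁻¹ • v with hz
  have hzz : z + z = v := by rw [hz, ← add_smul]; norm_num
  have hzn : ‖z‖ = ‖v‖ / 2 := by rw [hz, norm_smul]; norm_num; ring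
  have hG : MemLp (fun x => ∑ i : Fin d × Fin d, z i.1 * z i.2 * g i.1 i.2 x) 2 volume :=
    memLp_finsetSum _ fun i _ => (hg i.1 i.2).const_mul _
  have e : secDiff f v = mixDiff f z z := by
    funext x
    simp only [secDiff, mixDiff, hzz, sub_self, add_zero]; ring
  rw [e]
  refine (eLpNorm_mixDiff_le hV hf hG (IsWeakDeriv.integral_fderiv_fderiv hf hg hw z z) ?_).trans ?_
  · intro x hx s hs t ht
    exact hVU x hx _ ((smul_add_smul_norm_le hs ht z z).trans (by linarith))
  · have hb : ∀ i : Fin d × Fin d, |z i.1 * z i.2| ≤ ‖z‖ * ‖z‖ := fun i => by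
      rw [abs_mul]
      exact mul_le_mul (abs_apply_le _ _) (abs_apply_le _ _) (abs_nonneg _) (norm_nonneg _)
    have := eLpNorm_sum_mul_le (ν := (volume : Measure (E d)))
      (c := fun i : Fin d × Fin d => z i.1 * z i.2) (F := fun i => g i.1 i.2)
      (fun i => (hg i.1 i.2).1) (by positivity) hb (fun i => hC i.1 i.2)
    calc _ ≤ 4 * ENNReal.ofReal (Fintype.card (Fin d × Fin d) * (‖z‖ * ‖z‖ * C)) := by gcongr
      _ = ENNReal.ofReal (4 * (Fintype.card (Fin d × Fin d) * (‖z‖ * ‖z‖ * C))) := by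
        rw [ENNReal.ofReal_mul (p := 4) (by norm_num), ENNReal.ofReal_ofNat]
      _ ≤ _ := ENNReal.ofReal_le_ofReal (by
        rw [hzn]; simp only [Fintype.card_prod, Fintype.card_fin, Nat.cast_mul]
        apply le_of_eq; ring)

end Differences

/-! ### Integral operators acting on second differences -/

/-- The scalar function `f` has weak second derivatives `g` on `U`, and on `V ⊆ U` their second
differences with increments shorter than `ρ` are bounded by `η` in `L²`.  The functions live on the
whole space, and the `ρ`-neighbourhood of `V` lies in `U`. -/
structure HessianModulus (U V : Set (E d)) (ρ η : ℝ) (f : E d → ℝ)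
    (g : Fin d → Fin d → E d → ℝ) : Prop where
  isOpen : IsOpen V
  add_mem : ∀ x ∈ V, ∀ h : E d, ‖h‖ < ρ → x + h ∈ U
  memLp : MemLp f 2 volume
  measurable : Measurable f
  memLp_hessian : ∀ k l, MemLp (g k l) 2 volume
  measurable_hessian : ∀ k l, Measurable (g k l)
  weak : ∀ k l, IsWeakDeriv U ![k, l] f (g k l)
  nonneg : 0 ≤ η
  modulus : ∀ k l, ∀ h : E d, ‖h‖ < ρ →
    eLpNorm (secDiff (g k l) h) 2 (volume.restrict V) ≤ ENNReal.ofReal η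

section Abstract

variable {U V : Set (E d)} {ρ η : ℝ} {f : E d → ℝ} {g : Fin d → Fin d → E d → ℝ}
  {P : Type*} [MeasurableSpace P] {μ : Measure P} [SFinite μ] {κ : P → ℝ} {ζ ξ : P → E d}

lemma measurable_mixDiff (hf : Measurable f) (hζ : Measurable ζ) (hξ : Measurable ξ) :
    Measurable fun q : P × E d => mixDiff f (ζ q.1) (ξ q.1) q.2 := by
  unfold mixDiff
  fun_prop

/-- An integral superposition of mixed differences is, up to the modulus `η`, a second-order
differential operator, whose coefficients are the moments of the kernel. -/
lemma HessianModulus.eLpNorm_integral_mixDiff_sub_le (H : HessianModulus U V ρ η f g)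
    (hκ : Measurable κ) (hζ : Measurable ζ) (hξ : Measurable ξ)
    (hint : Integrable (fun p => κ p * (‖ζ p‖ * ‖ξ p‖)) μ)
    (hsmall : ∀ᵐ p ∂μ, ‖ζ p‖ + ‖ξ p‖ < ρ) :
    (∀ᵐ x ∂volume.restrict V, Integrable (fun p => κ p * mixDiff f (ζ p) (ξ p) x) μ) ∧
    eLpNorm (fun x => (∫ p, κ p * mixDiff f (ζ p) (ξ p) x ∂μ)
        - 4 * ∑ i : Fin d × Fin d, (∫ p, κ p * (ζ p i.1 * ξ p i.2) ∂μ) * g i.1 i.2 x)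
      2 (volume.restrict V) ≤
      ENNReal.ofReal (2 * (d * d * η) * ∫ p, |κ p| * (‖ζ p‖ * ‖ξ p‖) ∂μ) := by
  set b : P → E d → ℝ := fun p x => mixDiff f (ζ p) (ξ p) x
    - 4 * ∑ i : Fin d × Fin d, ζ p i.1 * ξ p i.2 * g i.1 i.2 x with hb
  have hζi : ∀ i, Measurable fun p => ζ p i := fun i => by fun_prop
  have hξi : ∀ i, Measurable fun p => ξ p i := fun i => by fun_prop
  have hbm : Measurable (Function.uncurry b) := by
    refine (measurable_mixDiff H.measurable hζ hξ).sub (Measurable.const_mul ?_ _)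
    refine Finset.measurable_sum _ fun i _ => ?_
    exact (((hζi _).comp measurable_fst).mul ((hξi _).comp measurable_fst)).mul
      ((H.measurable_hessian _ _).comp measurable_snd)
  have hb0 : ∀ p x, ‖ζ p‖ * ‖ξ p‖ = 0 → b p x = 0 := by
    intro p x h
    rcases mul_eq_zero.1 h with h | h <;> rw [norm_eq_zero] at h <;>
      simp [hb, mixDiff, h]
  obtain ⟨h1, h2⟩ := eLpNorm_integral_le (ν := volume.restrict V) hκ (hζ.norm.mul hξ.norm) hbm
    hint (fun p => by simp only [Pi.mul_apply]; positivity) hb0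
    (by have := H.nonneg; positivity : (0 : ℝ) ≤ 2 * (d * d * η))
    (hsmall.mono fun p hp _ => eLpNorm_mixDiff_sub_sum_le H.isOpen H.memLp H.memLp_hessian H.weak
      H.add_mem H.nonneg H.modulus hp)
  have h3 : ∀ i : Fin d × Fin d, Integrable (fun p => κ p * (ζ p i.1 * ξ p i.2)) μ := by
    intro i
    refine hint.mono (hκ.mul ((hζi _).mul (hξi _))).aestronglyMeasurable (.of_forall fun p => ?_)
    simp only [norm_mul, norm_norm]
    gcongr
    · exact PiLp.norm_apply_le _ _
    · exact PiLp.norm_apply_le _ _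
  have e : ∀ p x, κ p * (4 * ∑ i : Fin d × Fin d, ζ p i.1 * ξ p i.2 * g i.1 i.2 x)
      = ∑ i : Fin d × Fin d, κ p * (ζ p i.1 * ξ p i.2) * (4 * g i.1 i.2 x) := by
    intro p x
    rw [Finset.mul_sum, Finset.mul_sum]
    exact Finset.sum_congr rfl fun i _ => by ring
  have h4 : ∀ x, Integrable (fun p => κ p *
      (4 * ∑ i : Fin d × Fin d, ζ p i.1 * ξ p i.2 * g i.1 i.2 x)) μ := by
    intro x
    simp only [e]
    exact integrable_finsetSum _ fun i _ => (h3 i).mul_const _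
  have e2 : ∀ p x, κ p * mixDiff f (ζ p) (ξ p) x = κ p * b p x
      + κ p * (4 * ∑ i : Fin d × Fin d, ζ p i.1 * ξ p i.2 * g i.1 i.2 x) := by
    intro p x; simp only [hb]; ring
  refine ⟨?_, ?_⟩
  · filter_upwards [h1] with x hx
    simp only [e2]
    exact hx.add (h4 x)
  · refine le_of_eq_of_le (eLpNorm_congr_ae ?_) h2
    filter_upwards [h1] with x hx
    simp only [e2]
    rw [integral_add hx (h4 x)]
    simp only [e]
    rw [integral_finsetSum _ fun i _ => (h3 i).mul_const _, Finset.mul_sum, add_sub_assoc,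
      ← Finset.sum_sub_distrib, Finset.sum_eq_zero, add_zero]
    intro i _
    rw [integral_mul_const]; ring

end Abstract

/-! ### Kernel moments -/

section Kernel

variable {δ : ℝ} {K : ℝ → ℝ}

lemma IsKernel.integrable_mul (hK : IsKernel d δ K) {q : E d → ℝ} (hq : Measurable q) {C : ℝ}
    (h : ∀ z ∈ Metric.ball (0 : E d) δ, |q z| ≤ C * ‖z‖) :
    Integrable (fun z : E d => K ‖z‖ * q z) (volume.restrict (Metric.ball 0 δ)) := by
  have h1 := hK.integrable.norm.const_mul C
  refine h1.mono' ((hK.measurable.comp measurable_norm).mul hq).aestronglyMeasurable ?_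
  filter_upwards [ae_restrict_mem Metric.isOpen_ball.measurableSet] with z hz
  rw [norm_mul, norm_smul, Real.norm_eq_abs (q z), mul_left_comm]
  gcongr
  exact h z hz

lemma IsKernel.abs_mul_norm (hK : IsKernel d δ K) (z : E d) : |K ‖z‖| * ‖z‖ = K ‖z‖ * ‖z‖ := by
  rcases eq_or_ne z 0 with rfl | hz
  · simp
  · rw [abs_of_nonneg (hK.nonneg _ (norm_pos_iff.2 hz))]

lemma abs_apply_mul_le (z : E d) (i j : Fin d) : |z i * z j| ≤ ‖z‖ * ‖z‖ := by
  rw [abs_mul]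
  exact mul_le_mul (abs_apply_le _ _) (abs_apply_le _ _) (abs_nonneg _) (norm_nonneg _)

lemma norm_le_of_mem_ball {z : E d} (hz : z ∈ Metric.ball (0 : E d) δ) : ‖z‖ ≤ δ :=
  (mem_ball_zero_iff.1 hz).le

lemma IsKernel.integrable_norm_sq (hK : IsKernel d δ K) :
    Integrable (fun z : E d => K ‖z‖ * ‖z‖ ^ 2) (volume.restrict (Metric.ball 0 δ)) :=
  hK.integrable_mul (by fun_prop) (C := δ) fun z hz => by
    rw [abs_of_nonneg (by positivity), pow_two]
    gcongr
    exact norm_le_of_mem_ball hz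

lemma IsKernel.integrable_apply_mul_apply (hK : IsKernel d δ K) (i j : Fin d) :
    Integrable (fun z : E d => K ‖z‖ * z i * z j) (volume.restrict (Metric.ball 0 δ)) := by
  simp only [mul_assoc]
  refine hK.integrable_mul (by fun_prop) (C := δ) fun z hz => (abs_apply_mul_le z i j).trans ?_
  gcongr
  exact norm_le_of_mem_ball hz

lemma IsKernel.measurable_norm (hK : IsKernel d δ K) : Measurable fun z : E d => K ‖z‖ :=
  hK.measurable.comp _root_.measurable_norm

lemma measurePreserving_neg_ball (δ : ℝ) :
    MeasurePreserving (MeasurableEquiv.neg (E d)) (volume.restrict (Metric.ball 0 δ))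
      (volume.restrict (Metric.ball 0 δ)) := by
  have h := (Measure.measurePreserving_neg (volume : Measure (E d))).restrict_preimage
    (s := Metric.ball 0 δ) Metric.isOpen_ball.measurableSet
  have e : (Neg.neg ⁻¹' Metric.ball (0 : E d) δ) = Metric.ball 0 δ := by
    ext; simp
  rwa [e] at h

end Kernel

/-! ### The scalar building block of the iterated operator -/

section DoubleIntegral

variable {U V : Set (E d)} {ρ η δ : ℝ} {f : E d → ℝ} {g : Fin d → Fin d → E d → ℝ} {K : ℝ → ℝ}

/-- Lebesgue measure on `B_δ × B_δ`. -/
noncomputable abbrev ballProd (d : ℕ) (δ : ℝ) : Measure (E d × E d) :=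
  (volume.restrict (Metric.ball 0 δ)).prod (volume.restrict (Metric.ball 0 δ))

/-- The density `K(|z|) z_i K(|w|) w_j` on `B_δ × B_δ`. -/
noncomputable def doubleKernel (K : ℝ → ℝ) (i j : Fin d) (p : E d × E d) : ℝ :=
  (K ‖p.1‖ * p.1 i) * (K ‖p.2‖ * p.2 j)

lemma IsKernel.measurable_doubleKernel (hK : IsKernel d δ K) (i j : Fin d) :
    Measurable (doubleKernel K i j) := by
  have := hK.measurable
  unfold doubleKernel
  fun_prop

lemma IsKernel.integrable_apply (hK : IsKernel d δ K) (i : Fin d) :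
    Integrable (fun z : E d => K ‖z‖ * z i) (volume.restrict (Metric.ball 0 δ)) :=
  hK.integrable_mul (by fun_prop) (C := 1) fun z _ => by rw [one_mul]; exact abs_apply_le z i

lemma IsKernel.integrable_doubleKernel (hK : IsKernel d δ K) (i j : Fin d) :
    Integrable (doubleKernel K i j) (ballProd d δ) :=
  (hK.integrable_apply i).mul_prod (hK.integrable_apply j)

/-- Outside a null set, the double integral defining the iterated operator converges absolutely. -/
lemma IsKernel.ae_integrable_doubleKernel (hK : IsKernel d δ K) (hf : MemLp f 2 volume)
    (hfm : Measurable f) (i j : Fin d) :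
    ∀ᵐ x, Integrable (fun p => doubleKernel K i j p * f (x + (p.1 + p.2))) (ballProd d δ) := by
  have hb : Measurable (Function.uncurry fun (p : E d × E d) x => f (x + (p.1 + p.2))) :=
    hfm.comp (measurable_snd.add ((measurable_fst.comp measurable_fst).add
      (measurable_snd.comp measurable_fst)))
  have hint : Integrable (fun p => doubleKernel K i j p * 1) (ballProd d δ) := by
    simpa using hK.integrable_doubleKernel i j
  refine (eLpNorm_integral_le (μ := ballProd d δ) (ν := volume) (N := fun _ => (1 : ℝ))
    (c := (eLpNorm f 2 volume).toReal) (hK.measurable_doubleKernel i j) measurable_const hb hint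
    (fun _ => zero_le_one) (fun _ _ h => absurd h one_ne_zero) ENNReal.toReal_nonneg
    (.of_forall fun p _ => ?_)).1
  rw [eLpNorm_translate hf.1, mul_one, ENNReal.ofReal_toReal hf.2.ne]

/-- By the symmetry of the kernel, the translate `f(x + z + w)` may be replaced by a quarter of
the mixed difference. -/
lemma IsKernel.integral_doubleKernel_eq (i j : Fin d) {x : E d}
    (hx : Integrable (fun p => doubleKernel K i j p * f (x + (p.1 + p.2))) (ballProd d δ)) :
    ∫ p, doubleKernel K i j p * mixDiff f p.1 p.2 x ∂ballProd d δ
      = 4 * ∫ p, doubleKernel K i j p * f (x + (p.1 + p.2)) ∂ballProd d δ := by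
  set F : E d × E d → ℝ := fun p => doubleKernel K i j p * f (x + (p.1 + p.2)) with hF
  have hn := measurePreserving_neg_ball (d := d) δ
  have hi := MeasurePreserving.id (volume.restrict (Metric.ball (0 : E d) δ))
  have hT₁ : MeasurePreserving ((MeasurableEquiv.neg (E d)).prodCongr (.refl (E d)))
      (ballProd d δ) (ballProd d δ) := hn.prod hi
  have hT₂ : MeasurePreserving ((MeasurableEquiv.refl (E d)).prodCongr (.neg (E d)))
      (ballProd d δ) (ballProd d δ) := hi.prod hn
  have hT₃ : MeasurePreserving ((MeasurableEquiv.neg (E d)).prodCongr (.neg (E d)))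
      (ballProd d δ) (ballProd d δ) := hn.prod hn
  have i₁ := (hT₁.integrable_comp_emb (MeasurableEquiv.measurableEmbedding _)).2 hx
  have i₂ := (hT₂.integrable_comp_emb (MeasurableEquiv.measurableEmbedding _)).2 hx
  have i₃ := (hT₃.integrable_comp_emb (MeasurableEquiv.measurableEmbedding _)).2 hx
  have e₁ := hT₁.integral_comp' F
  have e₂ := hT₂.integral_comp' F
  have e₃ := hT₃.integral_comp' F
  have e : ∀ p : E d × E d, doubleKernel K i j p * mixDiff f p.1 p.2 x
      = F p + F ((MeasurableEquiv.refl (E d)).prodCongr (.neg (E d)) p)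
        + F ((MeasurableEquiv.neg (E d)).prodCongr (.refl (E d)) p)
        + F ((MeasurableEquiv.neg (E d)).prodCongr (.neg (E d)) p) := by
    rintro ⟨z, w⟩
    have a₂ : F ((MeasurableEquiv.refl (E d)).prodCongr (.neg (E d)) (z, w))
        = -(doubleKernel K i j (z, w) * f (x + (z - w))) := by
      change F (z, -w) = _
      simp only [hF, doubleKernel, norm_neg, PiLp.neg_apply, sub_eq_add_neg]; ring
    have a₁ : F ((MeasurableEquiv.neg (E d)).prodCongr (.refl (E d)) (z, w))
        = -(doubleKernel K i j (z, w) * f (x + (w - z))) := by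
      change F (-z, w) = _
      simp only [hF, doubleKernel, norm_neg, PiLp.neg_apply, sub_eq_add_neg, add_comm w]; ring
    have a₃ : F ((MeasurableEquiv.neg (E d)).prodCongr (.neg (E d)) (z, w))
        = doubleKernel K i j (z, w) * f (x + -(z + w)) := by
      change F (-z, -w) = _
      simp only [hF, doubleKernel, norm_neg, PiLp.neg_apply, neg_add]; ring
    rw [a₁, a₂, a₃]
    simp only [hF, mixDiff]; ring
  simp only [e]
  rw [integral_add, integral_add, integral_add, e₁, e₂, e₃]
  · ring
  · exact hx
  · exact i₂
  · exact hx.add i₂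
  · exact i₁
  · exact (hx.add i₂).add i₁
  · exact i₃

lemma HessianModulus.eLpNorm_double_sub_le (H : HessianModulus U V ρ η f g)
    (hK : IsKernel d δ K) (hδ : 2 * δ ≤ ρ) (i j : Fin d) :
    eLpNorm (fun x => (∫ p, doubleKernel K i j p * f (x + (p.1 + p.2)) ∂ballProd d δ)
        - ∑ a : Fin d × Fin d, ((∫ z in Metric.ball (0 : E d) δ, K ‖z‖ * z i * z a.1) *
            ∫ w in Metric.ball (0 : E d) δ, K ‖w‖ * w j * w a.2) * g a.1 a.2 x)
      2 (volume.restrict V) ≤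
      ENNReal.ofReal (d * d * η * weightedVolume d K δ ^ 2) := by
  have habs : ∀ (i : Fin d) (z : E d), |K ‖z‖ * z i| * ‖z‖ ≤ K ‖z‖ * ‖z‖ ^ 2 := by
    intro i z
    rw [abs_mul, mul_right_comm, hK.abs_mul_norm, pow_two, ← mul_assoc]
    have := (hK.abs_mul_norm z).symm ▸ mul_nonneg (abs_nonneg (K ‖z‖)) (norm_nonneg z)
    gcongr
    exact abs_apply_le z i
  have hmom : ∀ i : Fin d, Integrable (fun z : E d => K ‖z‖ * z i * ‖z‖)
      (volume.restrict (Metric.ball 0 δ)) := by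
    intro i
    simp only [mul_assoc]
    refine hK.integrable_mul (by fun_prop) (C := δ) fun z hz => ?_
    rw [abs_mul, abs_norm]
    gcongr
    exact (abs_apply_le z i).trans (norm_le_of_mem_ball hz)
  have hint : Integrable (fun p : E d × E d => doubleKernel K i j p * (‖p.1‖ * ‖p.2‖))
      (ballProd d δ) := by
    refine ((hmom i).mul_prod (hmom j)).congr (.of_forall fun p => ?_)
    simp only [doubleKernel]; ring
  have hball : ∀ᵐ p ∂ballProd d δ, ‖p.1‖ < δ ∧ ‖p.2‖ < δ := by
    rw [ballProd, Measure.prod_restrict]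
    filter_upwards [ae_restrict_mem (Metric.isOpen_ball.measurableSet.prod
      Metric.isOpen_ball.measurableSet)] with p hp
    exact ⟨mem_ball_zero_iff.1 hp.1, mem_ball_zero_iff.1 hp.2⟩
  obtain ⟨-, h1⟩ := H.eLpNorm_integral_mixDiff_sub_le (hK.measurable_doubleKernel i j)
    measurable_fst measurable_snd hint (hball.mono fun p hp => by linarith [hp.1, hp.2])
  have hle : ∫ p, |doubleKernel K i j p| * (‖p.1‖ * ‖p.2‖) ∂ballProd d δ
      ≤ weightedVolume d K δ ^ 2 := by
    calc _ ≤ ∫ p : E d × E d, (K ‖p.1‖ * ‖p.1‖ ^ 2) * (K ‖p.2‖ * ‖p.2‖ ^ 2) ∂ballProd d δ := by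
          refine integral_mono_of_nonneg (.of_forall fun p => by
            simp only [Pi.zero_apply]; positivity)
            (hK.integrable_norm_sq.mul_prod hK.integrable_norm_sq) (.of_forall fun p => ?_)
          simp only [doubleKernel]
          rw [abs_mul, mul_mul_mul_comm]
          exact mul_le_mul (habs i _) (habs j _) (by positivity) ((by positivity : (0 : ℝ) ≤
            |K ‖p.1‖ * p.1 i| * ‖p.1‖).trans (habs i _))
      _ = _ := by
          rw [ballProd, integral_prod_mul (fun z : E d => K ‖z‖ * ‖z‖ ^ 2)
            (fun z : E d => K ‖z‖ * ‖z‖ ^ 2), pow_two]; rfl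
  have hη := H.nonneg
  have e : (fun x => (∫ p, doubleKernel K i j p * f (x + (p.1 + p.2)) ∂ballProd d δ)
        - ∑ a : Fin d × Fin d, ((∫ z in Metric.ball (0 : E d) δ, K ‖z‖ * z i * z a.1) *
            ∫ w in Metric.ball (0 : E d) δ, K ‖w‖ * w j * w a.2) * g a.1 a.2 x)
      =ᵐ[volume.restrict V] (4⁻¹ : ℝ) • fun x =>
        (∫ p, doubleKernel K i j p * mixDiff f p.1 p.2 x ∂ballProd d δ) -
          4 * ∑ a : Fin d × Fin d,
            (∫ p, doubleKernel K i j p * (p.1 a.1 * p.2 a.2) ∂ballProd d δ) * g a.1 a.2 x := by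
    filter_upwards [ae_restrict_of_ae (hK.ae_integrable_doubleKernel H.memLp H.measurable i j)]
      with x hx
    rw [Pi.smul_apply, IsKernel.integral_doubleKernel_eq i j hx, ← mul_sub, smul_eq_mul,
      inv_mul_cancel_left₀ (by norm_num)]
    congr 1
    refine Finset.sum_congr rfl fun a _ => ?_
    rw [← integral_prod_mul (fun z : E d => K ‖z‖ * z i * z a.1)
            (fun w : E d => K ‖w‖ * w j * w a.2)]
    congr 1
    refine integral_congr_ae (.of_forall fun p => ?_)
    simp only [doubleKernel]; ring
  rw [eLpNorm_congr_ae e]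
  refine eLpNorm_const_smul_le.trans ?_
  calc _ ≤ ENNReal.ofReal 4⁻¹ * ENNReal.ofReal (2 * (d * d * η) *
        ∫ p, |doubleKernel K i j p| * (‖p.1‖ * ‖p.2‖) ∂ballProd d δ) := by
        gcongr
        rw [← ofReal_norm]; norm_num
    _ ≤ _ := by
        rw [← ENNReal.ofReal_mul (by norm_num)]
        apply ENNReal.ofReal_le_ofReal
        calc _ ≤ 4⁻¹ * (2 * (d * d * η) * weightedVolume d K δ ^ 2) := by gcongr
          _ ≤ _ := by
            have : 0 ≤ d * d * η * weightedVolume d K δ ^ 2 := by positivity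
            linarith

end DoubleIntegral

/-! ### The scalar building block of the bond-based operator -/

section SingleIntegral

variable {U V : Set (E d)} {ρ η δ : ℝ} {f : E d → ℝ} {g : Fin d → Fin d → E d → ℝ} {K : ℝ → ℝ}

/-- The density `K(|z|) z_i z_j / |z|²`. -/
noncomputable def bondKernel (K : ℝ → ℝ) (i j : Fin d) (z : E d) : ℝ := K ‖z‖ * (z i * z j / ‖z‖ ^ 2)

lemma IsKernel.measurable_bondKernel (hK : IsKernel d δ K) (i j : Fin d) :
    Measurable (bondKernel K i j) := by
  have := hK.measurable
  unfold bondKernel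
  fun_prop

lemma abs_apply_mul_div_le (z : E d) (i j : Fin d) : |z i * z j / ‖z‖ ^ 2| ≤ 1 := by
  rw [abs_div, abs_of_nonneg (by positivity : 0 ≤ ‖z‖ ^ 2), pow_two]
  exact div_le_one_of_le₀ (abs_apply_mul_le z i j) (by positivity)

lemma IsKernel.integrable_bondKernel_mul (hK : IsKernel d δ K) (i j : Fin d) {q : E d → ℝ}
    (hq : Measurable q) {C : ℝ} (h : ∀ z ∈ Metric.ball (0 : E d) δ, |q z| ≤ C * ‖z‖) :
    Integrable (fun z => bondKernel K i j z * q z) (volume.restrict (Metric.ball 0 δ)) := by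
  simp only [bondKernel, mul_assoc]
  refine hK.integrable_mul (by fun_prop) (C := C) fun z hz => ?_
  rw [abs_mul]
  exact (mul_le_of_le_one_left (abs_nonneg _) (abs_apply_mul_div_le z i j)).trans (h z hz)

/-- Outside a null set, the integral defining the bond-based operator converges absolutely.  As the
kernel itself need not be integrable, this uses the weak gradient of `f`. -/
lemma IsKernel.ae_integrable_bondKernel (hK : IsKernel d δ K) (hV : IsOpen V)
    (hVU : ∀ x ∈ V, ∀ h : E d, ‖h‖ < ρ → x + h ∈ U) (hδ : δ ≤ ρ)
    (hf : MemLp f 2 volume) (hfm : Measurable f) {G : Fin d → E d → ℝ}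
    (hG : ∀ k, MemLp (G k) 2 volume) (hw : ∀ k, IsWeakDeriv U ![k] f (G k)) (i j : Fin d) :
    ∀ᵐ x ∂volume.restrict V, Integrable (fun z => bondKernel K i j z * (f (x + z) - f x))
      (volume.restrict (Metric.ball 0 δ)) := by
  set C : ℝ := ∑ k, (eLpNorm (G k) 2 volume).toReal
  have hC : ∀ k, eLpNorm (G k) 2 volume ≤ ENNReal.ofReal C := fun k => by
    rw [← ENNReal.ofReal_toReal (hG k).2.ne]
    exact ENNReal.ofReal_le_ofReal (Finset.single_le_sum
      (f := fun k => (eLpNorm (G k) 2 volume).toReal)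
      (fun k _ => ENNReal.toReal_nonneg) (Finset.mem_univ k))
  have hC0 : 0 ≤ C := Finset.sum_nonneg fun k _ => ENNReal.toReal_nonneg
  refine (eLpNorm_integral_le (ν := volume.restrict V) (N := fun z : E d => ‖z‖)
    (b := fun z x => f (x + z) - f x) (c := d * C)
    (hK.measurable_bondKernel i j) (by fun_prop) ?_ ?_ (fun _ => norm_nonneg _) (fun z x h => ?_)
    (by positivity) ?_).1
  · simp only [Function.uncurry_def]; fun_prop
  · exact hK.integrable_bondKernel_mul i j (by fun_prop) (C := 1) fun z _ => by simp
  · rw [norm_eq_zero] at h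
    simp [h]
  · filter_upwards [ae_restrict_mem Metric.isOpen_ball.measurableSet] with z hz _
    exact eLpNorm_sub_translate_le_norm hV hf hG hw hVU hC
      ((mem_ball_zero_iff.1 hz).trans_le hδ)

/-- By the symmetry of the kernel, the first difference may be replaced by half of the second
difference. -/
lemma integral_bondKernel_eq (i j : Fin d) {x : E d}
    (hx : Integrable (fun z => bondKernel K i j z * (f (x + z) - f x))
      (volume.restrict (Metric.ball 0 δ))) :
    ∫ z in Metric.ball 0 δ, bondKernel K i j z * mixDiff f ((2 : ℝ)⁻¹ • z) ((2 : ℝ)⁻¹ • z) x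
      = 2 * ∫ z in Metric.ball 0 δ, bondKernel K i j z * (f (x + z) - f x) := by
  set F : E d → ℝ := fun z => bondKernel K i j z * (f (x + z) - f x) with hF
  have hn := measurePreserving_neg_ball (d := d) δ
  have i₁ : Integrable (fun z => F (MeasurableEquiv.neg (E d) z))
      (volume.restrict (Metric.ball 0 δ)) :=
    (hn.integrable_comp_emb (MeasurableEquiv.measurableEmbedding _)).2 hx
  have e₁ := hn.integral_comp' F
  have e : ∀ z : E d, bondKernel K i j z * mixDiff f ((2 : ℝ)⁻¹ • z) ((2 : ℝ)⁻¹ • z) x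
      = F z + F (MeasurableEquiv.neg (E d) z) := by
    intro z
    change _ = F z + F (-z)
    have hz : (2 : ℝ)⁻¹ • z + (2 : ℝ)⁻¹ • z = z := by rw [← add_smul]; norm_num
    simp only [hF, bondKernel, norm_neg, PiLp.neg_apply, mixDiff, hz, sub_self, add_zero]; ring
  simp only [e]
  rw [integral_add hx i₁, e₁]; ring

lemma HessianModulus.eLpNorm_single_sub_le (H : HessianModulus U V ρ η f g)
    (hK : IsKernel d δ K) (hδ : δ ≤ ρ) {G : Fin d → E d → ℝ}
    (hG : ∀ k, MemLp (G k) 2 volume) (hw : ∀ k, IsWeakDeriv U ![k] f (G k)) (i j : Fin d) :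
    eLpNorm (fun x => (∫ z in Metric.ball 0 δ, bondKernel K i j z * (f (x + z) - f x))
        - ∑ a : Fin d × Fin d, (2⁻¹ * ∫ z in Metric.ball (0 : E d) δ,
            K ‖z‖ * z i * z j * z a.1 * z a.2 / ‖z‖ ^ 2) * g a.1 a.2 x)
      2 (volume.restrict V) ≤
      ENNReal.ofReal (d * d * η * weightedVolume d K δ) := by
  have hhalf : ∀ z : E d, ‖(2 : ℝ)⁻¹ • z‖ = ‖z‖ / 2 := fun z => by
    rw [norm_smul]; norm_num; ring
  have hint : Integrable (fun z : E d => bondKernel K i j z *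
      (‖(2 : ℝ)⁻¹ • z‖ * ‖(2 : ℝ)⁻¹ • z‖)) (volume.restrict (Metric.ball 0 δ)) := by
    refine hK.integrable_bondKernel_mul i j (by fun_prop) (C := δ) fun z hz => ?_
    rw [abs_of_nonneg (by positivity), hhalf]
    have := norm_le_of_mem_ball hz
    gcongr <;> linarith [norm_nonneg z]
  have hball : ∀ᵐ z ∂volume.restrict (Metric.ball (0 : E d) δ),
      ‖(2 : ℝ)⁻¹ • z‖ + ‖(2 : ℝ)⁻¹ • z‖ < ρ := by
    filter_upwards [ae_restrict_mem Metric.isOpen_ball.measurableSet] with z hz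
    rw [hhalf]
    linarith [mem_ball_zero_iff.1 hz]
  obtain ⟨-, h1⟩ := H.eLpNorm_integral_mixDiff_sub_le (hK.measurable_bondKernel i j)
    (measurable_id.const_smul (2 : ℝ)⁻¹) (measurable_id.const_smul (2 : ℝ)⁻¹) hint hball
  have hle : ∫ z in Metric.ball (0 : E d) δ, |bondKernel K i j z| *
      (‖(2 : ℝ)⁻¹ • z‖ * ‖(2 : ℝ)⁻¹ • z‖) ≤ weightedVolume d K δ := by
    refine integral_mono_of_nonneg (.of_forall fun z => by
      simp only [Pi.zero_apply]; positivity) hK.integrable_norm_sq (.of_forall fun z => ?_)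
    simp only [bondKernel]
    rw [abs_mul, hhalf]
    calc |K ‖z‖| * |z i * z j / ‖z‖ ^ 2| * (‖z‖ / 2 * (‖z‖ / 2))
        ≤ |K ‖z‖| * 1 * (‖z‖ * ‖z‖) := by
          have := abs_apply_mul_div_le z i j
          gcongr <;> linarith [norm_nonneg z]
      _ = K ‖z‖ * ‖z‖ ^ 2 := by
          rw [mul_one, ← mul_assoc, hK.abs_mul_norm]; ring
  have hη := H.nonneg
  have e : (fun x => (∫ z in Metric.ball 0 δ, bondKernel K i j z * (f (x + z) - f x))
        - ∑ a : Fin d × Fin d, (2⁻¹ * ∫ z in Metric.ball (0 : E d) δ,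
            K ‖z‖ * z i * z j * z a.1 * z a.2 / ‖z‖ ^ 2) * g a.1 a.2 x)
      =ᵐ[volume.restrict V] (2⁻¹ : ℝ) • fun x =>
        (∫ z in Metric.ball 0 δ, bondKernel K i j z *
            mixDiff f ((2 : ℝ)⁻¹ • z) ((2 : ℝ)⁻¹ • z) x) -
          4 * ∑ a : Fin d × Fin d, (∫ z in Metric.ball 0 δ, bondKernel K i j z *
            (((2 : ℝ)⁻¹ • z) a.1 * ((2 : ℝ)⁻¹ • z) a.2)) * g a.1 a.2 x := by
    filter_upwards [hK.ae_integrable_bondKernel H.isOpen H.add_mem hδ H.memLp H.measurable hG hw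
      i j] with x hx
    rw [Pi.smul_apply, integral_bondKernel_eq i j hx, smul_eq_mul, mul_sub,
      inv_mul_cancel_left₀ (by norm_num), Finset.mul_sum, Finset.mul_sum]
    congr 1
    refine Finset.sum_congr rfl fun a _ => ?_
    have e' : ∫ z in Metric.ball (0 : E d) δ, bondKernel K i j z *
          (((2 : ℝ)⁻¹ • z) a.1 * ((2 : ℝ)⁻¹ • z) a.2)
        = 4⁻¹ * ∫ z in Metric.ball (0 : E d) δ,
            K ‖z‖ * z i * z j * z a.1 * z a.2 / ‖z‖ ^ 2 := by
      rw [← integral_const_mul]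
      refine integral_congr_ae (.of_forall fun z => ?_)
      simp only [bondKernel, PiLp.smul_apply, smul_eq_mul]; ring
    rw [e']; ring
  rw [eLpNorm_congr_ae e]
  refine eLpNorm_const_smul_le.trans ?_
  calc _ ≤ ENNReal.ofReal 2⁻¹ * ENNReal.ofReal (2 * (d * d * η) *
        ∫ z in Metric.ball (0 : E d) δ, |bondKernel K i j z| *
          (‖(2 : ℝ)⁻¹ • z‖ * ‖(2 : ℝ)⁻¹ • z‖)) := by
        gcongr
        · rw [← ofReal_norm]; norm_num
        · exact h1
    _ ≤ _ := by
        rw [← ENNReal.ofReal_mul (by norm_num)]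
        apply ENNReal.ofReal_le_ofReal
        calc _ ≤ 2⁻¹ * (2 * (d * d * η) * weightedVolume d K δ) := by gcongr
          _ = _ := by ring

end SingleIntegral

/-! ### From weak derivatives of vector fields on `U` to scalar functions on the whole space -/

section WeakDeriv

variable {U : Set (E d)} {u g g' : E d → E d}

lemma IsTest.partialDeriv {φ : E d → ℝ} (hφ : IsTest U φ) {n : ℕ} (J : Fin n → Fin d) :
    IsTest U (partialDeriv J φ) := by
  induction n generalizing φ with
  | zero =>
    have : Peridynamics.partialDeriv J φ = φ := by funext x; simp [Peridynamics.partialDeriv]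
    rwa [this]
  | succ n ih =>
    rw [← Fin.snoc_init_self J, partialDeriv_snoc hφ.contDiff]
    exact ih (hφ.partialDeriv_one _) _

lemma IsTest.integrable_smul {φ : E d → ℝ} (hφ : IsTest U φ) (hg : LocallyIntegrableOn g U) :
    Integrable (fun x => φ x • g x) := by
  have h := (hg.integrableOn_compact_subset hφ.tsupport_subset
    hφ.hasCompactSupport.isCompact).continuousOn_smul hφ.contDiff.continuous.continuousOn
      hφ.hasCompactSupport.isCompact
  refine (integrableOn_iff_integrable_of_support_subset ?_).1 h
  exact (Function.support_smul_subset_left _ _).trans (subset_tsupport φ)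

/-- Weak derivatives are unique up to null sets. -/
lemma HasWeakDeriv.ae_eq (hU : IsOpen U) {n : ℕ} {J : Fin n → Fin d} (h : HasWeakDeriv U J u g)
    (h' : HasWeakDeriv U J u g') : g =ᵐ[volume.restrict U] g' := by
  have h0 := hU.ae_eq_zero_of_integral_contDiff_smul_eq_zero (h.2.1.sub h'.2.1) (by
    intro φ h1 h2 h3
    have hφ : IsTest U φ := ⟨h1, h2, h3⟩
    have e := (h.2.2 φ h1 h2 h3).symm.trans (h'.2.2 φ h1 h2 h3)
    rw [smul_right_inj (by simp), hφ.setIntegral_smul, hφ.setIntegral_smul] at e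
    simp only [Pi.sub_apply, smul_sub]
    rw [integral_sub (hφ.integrable_smul h.2.1) (hφ.integrable_smul h'.2.1), e, sub_self])
  rw [Filter.EventuallyEq, ae_restrict_iff' hU.measurableSet]
  filter_upwards [h0] with x hx hxU
  exact sub_eq_zero.1 (hx hxU)

lemma weakDeriv_spec (hU : IsOpen U) {n : ℕ} {J : Fin n → Fin d}
    (h : ∃ g, HasWeakDeriv U J u g ∧ MemLp g 2 (volume.restrict U)) :
    HasWeakDeriv U J u (weakDeriv U J u) ∧ MemLp (weakDeriv U J u) 2 (volume.restrict U) := by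
  obtain ⟨g, h1, h2⟩ := h
  have hex : ∃ g, HasWeakDeriv U J u g := ⟨g, h1⟩
  have h3 : HasWeakDeriv U J u (weakDeriv U J u) := by
    rw [weakDeriv, dif_pos hex]; exact hex.choose_spec
  exact ⟨h3, (memLp_congr_ae (h3.ae_eq hU h1)).2 h2⟩

lemma memLp_of_hasWeakDeriv_zero (hU : IsOpen U) {J : Fin 0 → Fin d}
    (h : ∃ g, HasWeakDeriv U J u g ∧ MemLp g 2 (volume.restrict U)) :
    MemLp u 2 (volume.restrict U) := by
  obtain ⟨g, h1, h2⟩ := h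
  have h3 : HasWeakDeriv U J u u :=
    ⟨h1.1, h1.1, fun φ _ _ _ => by simp [partialDeriv]⟩
  exact (memLp_congr_ae (h3.ae_eq hU h1)).2 h2

open Classical in
/-- A measurable representative of `v : U → ℝᵈ`, extended by zero to the whole space. -/
noncomputable def globalRep (U : Set (E d)) (v : E d → E d) : E d → E d :=
  if h : AEStronglyMeasurable v (volume.restrict U) then U.indicator (h.mk v) else 0

variable {v : E d → E d}

lemma measurable_globalRep (hU : IsOpen U) : Measurable (globalRep U v) := by
  rw [globalRep]
  split_ifs with h
  · exact h.stronglyMeasurable_mk.measurable.indicator hU.measurableSet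
  · exact measurable_const

lemma globalRep_ae_eq (hU : IsOpen U) (h : AEStronglyMeasurable v (volume.restrict U)) :
    globalRep U v =ᵐ[volume.restrict U] v := by
  rw [globalRep, dif_pos h]
  exact (indicator_ae_eq_restrict hU.measurableSet).trans h.ae_eq_mk.symm

lemma eLpNorm_globalRep (hU : IsOpen U) (h : AEStronglyMeasurable v (volume.restrict U)) :
    eLpNorm (globalRep U v) 2 volume = eLpNorm v 2 (volume.restrict U) := by
  rw [globalRep, dif_pos h, eLpNorm_indicator_eq_eLpNorm_restrict hU.measurableSet]
  exact eLpNorm_congr_ae h.ae_eq_mk.symm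

/-- The components of a measurable representative. -/
noncomputable def globalComp (U : Set (E d)) (v : E d → E d) (j : Fin d) (x : E d) : ℝ :=
  globalRep U v x j

lemma measurable_globalComp (hU : IsOpen U) (j : Fin d) : Measurable (globalComp U v j) := by
  have := measurable_globalRep (v := v) hU
  unfold globalComp
  fun_prop

lemma eLpNorm_globalComp_le (hU : IsOpen U) (h : AEStronglyMeasurable v (volume.restrict U))
    (j : Fin d) : eLpNorm (globalComp U v j) 2 volume ≤ eLpNorm v 2 (volume.restrict U) := by
  rw [← eLpNorm_globalRep hU h]
  exact eLpNorm_mono fun x => PiLp.norm_apply_le _ _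

lemma memLp_globalComp (hU : IsOpen U) (h : MemLp v 2 (volume.restrict U)) (j : Fin d) :
    MemLp (globalComp U v j) 2 volume :=
  ⟨(measurable_globalComp hU j).aestronglyMeasurable, (eLpNorm_globalComp_le hU h.1 j).trans_lt h.2⟩

lemma HasWeakDeriv.isWeakDeriv_globalComp (hU : IsOpen U) {n : ℕ} {J : Fin n → Fin d}
    (h : HasWeakDeriv U J u g) (hu : MemLp u 2 (volume.restrict U))
    (hg : MemLp g 2 (volume.restrict U)) (j : Fin d) :
    IsWeakDeriv U J (globalComp U u j) (globalComp U g j) := by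
  intro φ hφ
  have key : ∀ (ψ : E d → ℝ) (v : E d → E d), IsTest U ψ → LocallyIntegrableOn v U →
      MemLp v 2 (volume.restrict U) → ∫ x, ψ x * globalComp U v j x = (∫ x in U, ψ x • v x) j := by
    intro ψ v hψ hv hv2
    have e1 := hψ.setIntegral_smul (globalComp U v j)
    simp only [smul_eq_mul] at e1
    have e2 := (EuclideanSpace.proj j : E d →L[ℝ] ℝ).integral_comp_comm
      ((hψ.integrable_smul hv).restrict (s := U))
    rw [← e1]
    refine Eq.trans (integral_congr_ae ?_) e2
    filter_upwards [globalRep_ae_eq hU hv2.1] with x hx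
    simp [globalComp, hx]
  rw [key _ u (hφ.partialDeriv J) h.1 hu, key φ g hφ h.2.1 hg,
    h.2.2 φ hφ.contDiff hφ.hasCompactSupport hφ.tsupport_subset]
  simp

/-- The Gagliardo integral of a component is at most that of the vector field. -/
lemma gagliardo_globalComp_le (hU : IsOpen U) (h : AEStronglyMeasurable v (volume.restrict U))
    (r : ℝ) (j : Fin d) : gagliardo U r (globalComp U v j) ≤ gagliardoSq U r v := by
  have hae := globalRep_ae_eq hU h
  refine lintegral_mono_ae ?_
  filter_upwards [hae] with x hx
  refine lintegral_mono_ae ?_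
  filter_upwards [hae] with y hy
  apply ENNReal.ofReal_le_ofReal
  refine div_le_div_of_nonneg_right ?_ (by positivity)
  rw [← sq_abs, ← hx, ← hy]
  refine pow_le_pow_left₀ (abs_nonneg _) ?_ 2
  exact PiLp.norm_apply_le (globalRep U v y - globalRep U v x) j

end WeakDeriv

/-! ### The normalization constants -/

section Constants

variable {δ C : ℝ} {K : ℝ → ℝ}

lemma norm_sq_eq_sum (z : E d) : ‖z‖ ^ 2 = ∑ i, z i * z i := by
  rw [EuclideanSpace.real_norm_sq_eq]
  simp [pow_two]

lemma IsKernel.const_eq_of_normalizedA (hK : IsKernel d δ K) (hm : 0 < weightedVolume d K δ)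
    (h : NormalizedA d C K δ) : C = d := by
  have e : ∑ i : Fin d, ∫ z in Metric.ball (0 : E d) δ, K ‖z‖ * z i * z i
      = weightedVolume d K δ := by
    rw [← integral_finsetSum _ fun i _ => hK.integrable_apply_mul_apply i i, weightedVolume]
    refine integral_congr_ae (.of_forall fun z => ?_)
    simp only [norm_sq_eq_sum, Finset.mul_sum, mul_assoc]
  have h1 : ∑ i : Fin d, C / weightedVolume d K δ *
      ∫ z in Metric.ball (0 : E d) δ, K ‖z‖ * z i * z i = d := by
    simp [h _ _, idTensor]
  rw [← Finset.mul_sum, e, div_mul_cancel₀ _ hm.ne'] at h1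
  exact h1

lemma IsKernel.const_eq_of_normalizedB (hK : IsKernel d δ K) (hm : 0 < weightedVolume d K δ)
    (h : NormalizedB d C K δ) : C = 2 * d * (d + 2) := by
  have hint : ∀ i k : Fin d, Integrable (fun z : E d => K ‖z‖ * z i * z i * z k * z k / ‖z‖ ^ 2)
      (volume.restrict (Metric.ball 0 δ)) := by
    intro i k
    refine (hK.integrable_bondKernel_mul i i (q := fun z => z k * z k) (by fun_prop) (C := δ)
      fun z hz => (abs_apply_mul_le z k k).trans ?_).congr (.of_forall fun z => ?_)
    · gcongr; exact norm_le_of_mem_ball hz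
    · simp only [bondKernel]; ring
  have e : ∑ i : Fin d, ∑ k : Fin d, ∫ z in Metric.ball (0 : E d) δ,
      K ‖z‖ * z i * z i * z k * z k / ‖z‖ ^ 2 = weightedVolume d K δ := by
    simp only [← integral_finsetSum _ fun k _ => hint _ k]
    rw [← integral_finsetSum _ fun i _ => integrable_finsetSum _ fun k _ => hint i k,
      weightedVolume]
    refine integral_congr_ae (.of_forall fun z => ?_)
    have e' : ∑ i, ∑ k, K ‖z‖ * z i * z i * z k * z k / ‖z‖ ^ 2
        = K ‖z‖ * ((∑ i, z i * z i) * (∑ k, z k * z k)) / ‖z‖ ^ 2 := by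
      rw [Finset.sum_mul_sum, Finset.mul_sum, Finset.sum_div]
      refine Finset.sum_congr rfl fun i _ => ?_
      rw [Finset.mul_sum, Finset.sum_div]
      exact Finset.sum_congr rfl fun k _ => by ring
    simp only
    rw [e', ← norm_sq_eq_sum]
    rcases eq_or_ne z 0 with rfl | hz
    · simp
    · have := norm_ne_zero_iff.2 hz
      field_simp
  have h1 : ∑ i : Fin d, ∑ k : Fin d, C / (2 * weightedVolume d K δ) *
      ∫ z in Metric.ball (0 : E d) δ, K ‖z‖ * z i * z i * z k * z k / ‖z‖ ^ 2
        = d * d + 2 * d := by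
    simp only [h _ _ _ _, idTensor, symIdTensor, Finset.sum_add_distrib, ← Finset.mul_sum]
    simp
    ring
  simp only [← Finset.mul_sum] at h1
  rw [e] at h1
  field_simp at h1
  linarith

end Constants

/-! ### The vector operators in components -/

section Operators

variable {U Ω : Set (E d)} {δ C : ℝ} {K : ℝ → ℝ} {u v : E d → E d}

/-- Translates of an almost everywhere equality on `U`. -/
lemma ae_ball_translate_eq (hU : IsOpen U) (h : u =ᵐ[volume.restrict U] v) {x : E d}
    (hx : ∀ z ∈ Metric.ball (0 : E d) δ, x + z ∈ U) :
    ∀ᵐ z ∂volume.restrict (Metric.ball (0 : E d) δ), u (x + z) = v (x + z) := by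
  have h1 := (ae_restrict_iff' hU.measurableSet).1 h
  have h2 := (measurePreserving_add_left (volume : Measure (E d)) x).quasiMeasurePreserving.ae h1
  filter_upwards [ae_restrict_of_ae h2, ae_restrict_mem Metric.isOpen_ball.measurableSet]
    with z hz hz' using hz (hx z hz')

lemma opA_congr (hU : IsOpen U) (h : u =ᵐ[volume.restrict U] v) {x : E d}
    (hx : ∀ z, ‖z‖ < 2 * δ → x + z ∈ U) : opA C K δ u x = opA C K δ v x := by
  unfold opA
  congr 1
  refine setIntegral_congr_fun Metric.isOpen_ball.measurableSet fun z hz => ?_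
  have hd : dilatation K δ u (x + z) = dilatation K δ v (x + z) := by
    unfold dilatation
    congr 1
    refine integral_congr_ae ?_
    filter_upwards [ae_ball_translate_eq (δ := δ) hU h (x := x + z) fun w hw => by
      rw [add_assoc]
      refine hx _ ((norm_add_le z w).trans_lt ?_)
      linarith [mem_ball_zero_iff.1 hz, mem_ball_zero_iff.1 hw]] with w hw
    rw [hw]
  simp only [hd]

lemma opB_congr (hU : IsOpen U) (h : u =ᵐ[volume.restrict U] v) {x : E d}
    (hx : ∀ z, ‖z‖ < δ → x + z ∈ U) (hux : u x = v x) : opB C K δ u x = opB C K δ v x := by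
  unfold opB
  congr 1
  refine integral_congr_ae ?_
  filter_upwards [ae_ball_translate_eq (δ := δ) hU h (x := x) fun w hw =>
    hx w (mem_ball_zero_iff.1 hw)] with w hw
  rw [hw, hux]

lemma stronglyMeasurable_opA (hK : IsKernel d δ K) (hu : Measurable u) :
    StronglyMeasurable (opA C K δ u) := by
  have hKm := hK.measurable
  have h1 : StronglyMeasurable (dilatation K δ u) := by
    refine StronglyMeasurable.const_mul ?_ _
    refine StronglyMeasurable.integral_prod_right
      (f := fun x z => inner ℝ (K ‖z‖ • z) (u (x + z))) ?_
    refine Measurable.stronglyMeasurable ?_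
    simp only [Function.uncurry_def]
    fun_prop
  have h1' := h1.measurable
  refine (StronglyMeasurable.integral_prod_right
    (ν := volume.restrict (Metric.ball 0 δ)) (f := fun x z => dilatation K δ u (x + z) • (K ‖z‖ • z)) ?_).const_smul
      (C / weightedVolume d K δ)
  refine Measurable.stronglyMeasurable ?_
  simp only [Function.uncurry_def]
  fun_prop

lemma stronglyMeasurable_opB (hK : IsKernel d δ K) (hu : Measurable u) :
    StronglyMeasurable (opB C K δ u) := by
  have hKm := hK.measurable
  refine (StronglyMeasurable.integral_prod_right (ν := volume.restrict (Metric.ball 0 δ))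
    (f := fun x z => (inner ℝ z (u (x + z) - u x) / ‖z‖ ^ 2) • (K ‖z‖ • z)) ?_).const_smul
      (C / weightedVolume d K δ)
  refine Measurable.stronglyMeasurable ?_
  simp only [Function.uncurry_def]
  fun_prop

lemma inner_eq_sum_mul (z w : E d) : inner ℝ z w = ∑ j, z j * w j := by
  rw [PiLp.inner_apply]
  simp [mul_comm]

lemma opA_apply {x : E d} (hx : ∀ i j, Integrable
      (fun p => doubleKernel K i j p * u (x + (p.1 + p.2)) j) (ballProd d δ)) (i : Fin d) :
    opA C K δ u x i = ∑ j, C / weightedVolume d K δ * (d / weightedVolume d K δ) *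
      ∫ p, doubleKernel K i j p * u (x + (p.1 + p.2)) j ∂ballProd d δ := by
  set c : ℝ := d / weightedVolume d K δ with hc
  set F : Fin d → E d × E d → ℝ := fun i p =>
    ∑ j, c * (doubleKernel K i j p * u (x + (p.1 + p.2)) j) with hF
  have hFi : ∀ i, Integrable (F i) (ballProd d δ) := fun i =>
    integrable_finsetSum _ fun j _ => (hx i j).const_mul c
  have e : ∀ i (z : E d), (dilatation K δ u (x + z) • (K ‖z‖ • z)) i
      = ∫ w in Metric.ball (0 : E d) δ, F i (z, w) := by
    intro i z
    simp only [PiLp.smul_apply, smul_eq_mul, dilatation]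
    rw [← hc, mul_assoc, mul_comm (∫ w in _, _), ← mul_assoc, ← integral_const_mul]
    refine integral_congr_ae (.of_forall fun w => ?_)
    simp only [hF, doubleKernel, inner_eq_sum_mul, PiLp.smul_apply, smul_eq_mul, Finset.mul_sum,
      add_assoc]
    exact Finset.sum_congr rfl fun j _ => by ring
  have hi : ∀ i, Integrable (fun z => (dilatation K δ u (x + z) • (K ‖z‖ • z)) i)
      (volume.restrict (Metric.ball 0 δ)) := by
    intro i
    simp only [e]
    exact (hFi i).integral_prod_left
  rw [opA, PiLp.smul_apply, eval_integral_piLp hi, smul_eq_mul]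
  simp only [e]
  rw [← integral_prod _ (hFi i), integral_finsetSum _ fun j _ => (hx i j).const_mul c,
    Finset.mul_sum]
  refine Finset.sum_congr rfl fun j _ => ?_
  rw [integral_const_mul, mul_assoc]

lemma opB_apply {x : E d} (hx : ∀ i j, Integrable
      (fun z => bondKernel K i j z * (u (x + z) j - u x j)) (volume.restrict (Metric.ball 0 δ)))
    (i : Fin d) :
    opB C K δ u x i = ∑ j, C / weightedVolume d K δ *
      ∫ z in Metric.ball 0 δ, bondKernel K i j z * (u (x + z) j - u x j) := by
  have e : ∀ i (z : E d), ((inner ℝ z (u (x + z) - u x) / ‖z‖ ^ 2) • (K ‖z‖ • z)) i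
      = ∑ j, bondKernel K i j z * (u (x + z) j - u x j) := by
    intro i z
    simp only [PiLp.smul_apply, smul_eq_mul, inner_eq_sum_mul, Finset.sum_div, Finset.sum_mul,
      bondKernel, PiLp.sub_apply]
    exact Finset.sum_congr rfl fun j _ => by ring
  rw [opB, PiLp.smul_apply, eval_integral_piLp (fun i => by
    simp only [e]; exact integrable_finsetSum _ fun j _ => hx i j), smul_eq_mul]
  simp only [e]
  rw [integral_finsetSum _ fun j _ => hx i j, Finset.mul_sum]

lemma eLpNorm_le_sum_apply {X : Type*} [MeasurableSpace X] {ν : Measure X} {F : X → E d}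
    (hF : ∀ i, AEStronglyMeasurable (fun x => F x i) ν) :
    eLpNorm F 2 ν ≤ ∑ i, eLpNorm (fun x => F x i) 2 ν := by
  have h1 : eLpNorm F 2 ν ≤ eLpNorm (∑ i, fun x => ‖F x i‖) 2 ν := by
    refine eLpNorm_mono fun x => ?_
    rw [Finset.sum_apply, Real.norm_of_nonneg (Finset.sum_nonneg fun i _ => norm_nonneg _)]
    conv_lhs => rw [eq_sum_single (F x)]
    refine (norm_sum_le _ _).trans (Finset.sum_le_sum fun i _ => ?_)
    simp [norm_smul]
  refine (h1.trans (eLpNorm_sum_le (fun i _ => (hF i).norm) (by norm_num))).trans ?_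
  exact Finset.sum_le_sum fun i _ => (eLpNorm_norm _).le

/-- A vector field whose components are sums of `d` terms of norm at most `C`. -/
lemma eLpNorm_le_of_apply_eq_sum {X : Type*} [MeasurableSpace X] {ν : Measure X} {F : X → E d}
    {T : Fin d → Fin d → X → ℝ} (hT : ∀ i j, AEStronglyMeasurable (T i j) ν)
    (hF : ∀ i, (fun x => F x i) =ᵐ[ν] fun x => ∑ j, C * T i j x) {b B : ℝ}
    (hb : 0 ≤ b) (hC : |C| ≤ b) (h : ∀ i j, eLpNorm (T i j) 2 ν ≤ ENNReal.ofReal B) :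
    eLpNorm F 2 ν ≤ ENNReal.ofReal (d * (d * (b * B))) := by
  have hm : ∀ i, AEStronglyMeasurable (fun x => F x i) ν := fun i =>
    (Finset.aestronglyMeasurable_fun_sum _ fun j _ => (hT i j).const_mul C).congr (hF i).symm
  calc eLpNorm F 2 ν ≤ ∑ i, eLpNorm (fun x => F x i) 2 ν := eLpNorm_le_sum_apply hm
    _ ≤ ∑ _i : Fin d, ENNReal.ofReal (d * (b * B)) := by
        refine Finset.sum_le_sum fun i _ => ?_
        rw [eLpNorm_congr_ae (hF i)]
        refine (eLpNorm_sum_mul_le (c := fun _ => C) (hT i) hb (fun _ => hC) (h i)).trans ?_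
        rw [Fintype.card_fin]
    _ = _ := by
        rw [Finset.sum_const, Finset.card_univ, Fintype.card_fin, nsmul_eq_mul,
          ENNReal.ofReal_mul (p := (d : ℝ)) (q := d * (b * B)) (Nat.cast_nonneg d), ENNReal.ofReal_natCast]

end Operators

/-! ### Consistency of the vector operators -/

section Consistency

variable {U Ω : Set (E d)} {ρ η δ C : ℝ} {K : ℝ → ℝ} {u : E d → E d}

/-- The second weak derivatives of `u`, as scalar functions on the whole space, with a bound `η` on
their second differences. -/
structure VectorModulus (U Ω : Set (E d)) (ρ η : ℝ) (u : E d → E d) : Prop where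
  isOpen : IsOpen U
  measurableSet : MeasurableSet Ω
  subset : Ω ⊆ U
  memLp : MemLp u 2 (volume.restrict U)
  memLp_gradient : ∀ k, MemLp (weakDeriv U ![k] u) 2 (volume.restrict U)
  memLp_hessian : ∀ k l, MemLp (weakDeriv U ![k, l] u) 2 (volume.restrict U)
  weak_gradient : ∀ j k, IsWeakDeriv U ![k] (globalComp U u j) (globalComp U (weakDeriv U ![k] u) j)
  modulus : ∀ j, HessianModulus U Ω ρ η (globalComp U u j) fun k l => globalComp U (weakDeriv U ![k, l] u) j

lemma VectorModulus.ae_weakDeriv_eq (H : VectorModulus U Ω ρ η u) :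
    ∀ᵐ x ∂volume.restrict Ω, ∀ k l j, weakDeriv U ![k, l] u x j
      = globalComp U (weakDeriv U ![k, l] u) j x := by
  refine ae_restrict_of_ae_restrict_of_subset H.subset ?_
  simp only [ae_all_iff]
  intro k l j
  filter_upwards [globalRep_ae_eq H.isOpen (H.memLp_hessian k l).1] with x hx
  rw [globalComp, hx]

lemma VectorModulus.eLpNorm_opA_sub_le (H : VectorModulus U Ω ρ η u) (hK : IsKernel d δ K)
    (hm : 0 < weightedVolume d K δ) (hC : NormalizedA d C K δ) (hδ : 2 * δ ≤ ρ) :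
    eLpNorm (fun x => opA C K δ u x - gradDiv U u x) 2 (volume.restrict Ω) ≤
      ENNReal.ofReal (d ^ 6 * η) := by
  set m := weightedVolume d K δ with hmdef
  have hCd : C = d := hK.const_eq_of_normalizedA hm hC
  set M : Fin d → Fin d → ℝ := fun i k => ∫ z in Metric.ball (0 : E d) δ, K ‖z‖ * z i * z k with hM
  have hMC : ∀ i k, C / m * M i k = idTensor i k := hC
  set T : Fin d → Fin d → E d → ℝ := fun i j x =>
    (∫ p, doubleKernel K i j p * globalComp U u j (x + (p.1 + p.2)) ∂ballProd d δ)
      - ∑ a : Fin d × Fin d, (M i a.1 * M j a.2) * globalComp U (weakDeriv U ![a.1, a.2] u) j x with hT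
  have hcomp : ∀ j, Measurable (globalComp U u j) := fun j => measurable_globalComp H.isOpen j
  have hTm : ∀ i j, AEStronglyMeasurable (T i j) (volume.restrict Ω) := by
    intro i j
    refine AEStronglyMeasurable.sub (StronglyMeasurable.aestronglyMeasurable ?_)
      (Finset.aestronglyMeasurable_fun_sum _ fun a _ =>
        ((measurable_globalComp H.isOpen j).const_mul _).aestronglyMeasurable)
    refine StronglyMeasurable.integral_prod_right
      (f := fun x p => doubleKernel K i j p * globalComp U u j (x + (p.1 + p.2))) ?_
    refine Measurable.stronglyMeasurable ?_
    exact ((hK.measurable_doubleKernel i j).comp measurable_snd).mul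
      ((hcomp j).comp (measurable_fst.add ((measurable_fst.comp measurable_snd).add
        (measurable_snd.comp measurable_snd))))
  have hmain := eLpNorm_le_of_apply_eq_sum (F := fun x => opA C K δ u x - gradDiv U u x)
    (T := T) (C := C / m * (d / m)) (b := d / m * (d / m)) (B := d * d * η * m ^ 2) hTm ?_
    (by positivity) (by rw [hCd, abs_of_nonneg (by positivity)])
    (fun i j => (H.modulus j).eLpNorm_double_sub_le hK hδ i j)
  · refine hmain.trans (ENNReal.ofReal_le_ofReal (le_of_eq ?_))
    field_simp
  · intro i
    have hint : ∀ᵐ x ∂volume.restrict Ω, ∀ i j, Integrable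
        (fun p => doubleKernel K i j p * globalComp U u j (x + (p.1 + p.2))) (ballProd d δ) := by
      simp only [ae_all_iff]
      exact fun i j => ae_restrict_of_ae
        (hK.ae_integrable_doubleKernel (memLp_globalComp H.isOpen H.memLp j) (hcomp j) i j)
    filter_upwards [hint, H.ae_weakDeriv_eq, ae_restrict_mem H.measurableSet] with x hx hg hxΩ
    rw [PiLp.sub_apply, opA_congr H.isOpen (globalRep_ae_eq H.isOpen H.memLp.1).symm
      (fun z hz => (H.modulus i).add_mem x hxΩ z (hz.trans_le hδ)), opA_apply hx i, ← hmdef]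
    simp only [gradDiv, hT, mul_sub, Finset.sum_sub_distrib]
    congr 1
    refine Finset.sum_congr rfl fun j _ => ?_
    have e : ∀ a : Fin d × Fin d, C / m * (d / m) * (M i a.1 * M j a.2 *
        globalComp U (weakDeriv U ![a.1, a.2] u) j x)
        = idTensor i a.1 * idTensor j a.2 * globalComp U (weakDeriv U ![a.1, a.2] u) j x := by
      intro a
      rw [← hMC, ← hMC, hCd]; ring
    rw [Finset.mul_sum, Finset.sum_congr rfl fun a _ => e a, Fintype.sum_prod_type]
    simp [idTensor, hg]

lemma VectorModulus.eLpNorm_opB_sub_le (H : VectorModulus U Ω ρ η u) (hK : IsKernel d δ K)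
    (hm : 0 < weightedVolume d K δ) (hC : NormalizedB d C K δ) (hδ : δ ≤ ρ) :
    eLpNorm (fun x => opB C K δ u x - (gradDiv U u x + divSymGrad U u x)) 2 (volume.restrict Ω) ≤
      ENNReal.ofReal (2 * d ^ 5 * (d + 2) * η) := by
  set m := weightedVolume d K δ with hmdef
  have hCd : C = 2 * d * (d + 2) := hK.const_eq_of_normalizedB hm hC
  set M : Fin d → Fin d → Fin d → Fin d → ℝ := fun i j k l => ∫ z in Metric.ball (0 : E d) δ,
    K ‖z‖ * z i * z j * z k * z l / ‖z‖ ^ 2 with hM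
  have hMC : ∀ i j k l, C / (2 * m) * M i j k l
      = idTensor i j * idTensor k l + 2 * symIdTensor i j k l := hC
  set T : Fin d → Fin d → E d → ℝ := fun i j x =>
    (∫ z in Metric.ball 0 δ, bondKernel K i j z * (globalComp U u j (x + z) - globalComp U u j x))
      - ∑ a : Fin d × Fin d, (2⁻¹ * M i j a.1 a.2) * globalComp U (weakDeriv U ![a.1, a.2] u) j x with hT
  have hcomp : ∀ j, Measurable (globalComp U u j) := fun j => measurable_globalComp H.isOpen j
  have hTm : ∀ i j, AEStronglyMeasurable (T i j) (volume.restrict Ω) := by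
    intro i j
    refine AEStronglyMeasurable.sub (StronglyMeasurable.aestronglyMeasurable ?_)
      (Finset.aestronglyMeasurable_fun_sum _ fun a _ =>
        ((measurable_globalComp H.isOpen j).const_mul _).aestronglyMeasurable)
    refine StronglyMeasurable.integral_prod_right
      (f := fun x z => bondKernel K i j z * (globalComp U u j (x + z) - globalComp U u j x)) ?_
    refine Measurable.stronglyMeasurable ?_
    exact ((hK.measurable_bondKernel i j).comp measurable_snd).mul
      (((hcomp j).comp (measurable_fst.add measurable_snd)).sub ((hcomp j).comp measurable_fst))
  have hmain := eLpNorm_le_of_apply_eq_sum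
    (F := fun x => opB C K δ u x - (gradDiv U u x + divSymGrad U u x))
    (T := T) (C := C / m) (b := 2 * d * (d + 2) / m) (B := d * d * η * m) hTm ?_
    (by positivity) (by rw [hCd, abs_of_nonneg (by positivity)])
    (fun i j => (H.modulus j).eLpNorm_single_sub_le hK hδ
      (fun k => memLp_globalComp H.isOpen (H.memLp_gradient k) j) (H.weak_gradient j) i j)
  · refine hmain.trans (ENNReal.ofReal_le_ofReal (le_of_eq ?_))
    field_simp
  · intro i
    have hint : ∀ᵐ x ∂volume.restrict Ω, ∀ i j, Integrable
        (fun z => bondKernel K i j z * (globalComp U u j (x + z) - globalComp U u j x))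
        (volume.restrict (Metric.ball 0 δ)) := by
      simp only [ae_all_iff]
      exact fun i j => hK.ae_integrable_bondKernel (H.modulus i).isOpen (H.modulus i).add_mem hδ
        (memLp_globalComp H.isOpen H.memLp j) (hcomp j)
        (fun k => memLp_globalComp H.isOpen (H.memLp_gradient k) j) (H.weak_gradient j) i j
    filter_upwards [hint, H.ae_weakDeriv_eq, ae_restrict_mem H.measurableSet,
      ae_restrict_of_ae_restrict_of_subset H.subset (globalRep_ae_eq H.isOpen H.memLp.1)]
      with x hx hg hxΩ hux
    rw [PiLp.sub_apply, opB_congr H.isOpen (globalRep_ae_eq H.isOpen H.memLp.1).symm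
      (fun z hz => (H.modulus i).add_mem x hxΩ z (hz.trans_le hδ)) hux.symm, opB_apply hx i,
      ← hmdef]
    simp only [hT, mul_sub, Finset.sum_sub_distrib]
    congr 1
    have e : ∀ j, ∀ a : Fin d × Fin d, C / m * (2⁻¹ * M i j a.1 a.2 *
        globalComp U (weakDeriv U ![a.1, a.2] u) j x)
        = (idTensor i j * idTensor a.1 a.2 + (idTensor i a.1 * idTensor j a.2
          + idTensor i a.2 * idTensor j a.1)) * globalComp U (weakDeriv U ![a.1, a.2] u) j x := by
      intro j a
      have := hMC i j a.1 a.2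
      rw [symIdTensor] at this
      rw [show idTensor i j * idTensor a.1 a.2 + (idTensor i a.1 * idTensor j a.2
          + idTensor i a.2 * idTensor j a.1) = C / (2 * m) * M i j a.1 a.2 by rw [this]; ring]
      ring
    have e2 : ∀ j, C / m * ∑ a : Fin d × Fin d, 2⁻¹ * M i j a.1 a.2 *
        globalComp U (weakDeriv U ![a.1, a.2] u) j x
        = ∑ k, ∑ l, (idTensor i j * idTensor k l + (idTensor i k * idTensor j l
          + idTensor i l * idTensor j k)) * globalComp U (weakDeriv U ![k, l] u) j x := by
      intro j
      rw [Finset.mul_sum, Finset.sum_congr rfl fun a _ => e j a, Fintype.sum_prod_type]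
    simp only [e2, add_mul, Finset.sum_add_distrib]
    simp [gradDiv, divSymGrad, hg, idTensor, Finset.sum_add_distrib]
    ring

end Consistency

/-! ### Moduli of the second derivatives of a Sobolev function -/

section Sobolev

variable {U Ω : Set (E d)} {s α δ₀ : ℝ} {u : E d → E d}

lemma sobolevSeminorm_eq {n : ℕ} (hn : ⌊s⌋₊ = n) :
    sobolevSeminorm s U u = if s = n then
      (∑ J : Fin n → Fin d, eLpNorm (weakDeriv U J u) 2 (volume.restrict U) ^ 2) ^ (1 / 2 : ℝ)
    else (∑ J : Fin n → Fin d, gagliardoSq U (s - n) (weakDeriv U J u)) ^ (1 / 2 : ℝ) := by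
  subst hn; rfl

lemma sq_rpow_half (a : ℝ≥0∞) : (a ^ (1 / 2 : ℝ)) ^ 2 = a := by
  rw [← ENNReal.rpow_natCast, ← ENNReal.rpow_mul]; norm_num

lemma eLpNorm_weakDeriv_le_sobolevSeminorm {n : ℕ} (hs : s = n) (J : Fin n → Fin d) :
    eLpNorm (weakDeriv U J u) 2 (volume.restrict U) ≤ sobolevSeminorm s U u := by
  rw [sobolevSeminorm_eq (n := n) (by rw [hs, Nat.floor_natCast]), if_pos hs,
    ← ENNReal.pow_le_pow_left_iff two_ne_zero, sq_rpow_half]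
  exact Finset.single_le_sum
    (f := fun J : Fin n → Fin d => eLpNorm (weakDeriv U J u) 2 (volume.restrict U) ^ 2)
    (fun _ _ => zero_le) (Finset.mem_univ J)

lemma gagliardoSq_weakDeriv_le_sobolevSeminorm {n : ℕ} (hn : ⌊s⌋₊ = n) (hs : s ≠ n)
    (J : Fin n → Fin d) :
    gagliardoSq U (s - n) (weakDeriv U J u) ≤ sobolevSeminorm s U u ^ 2 := by
  rw [sobolevSeminorm_eq hn, if_neg hs, sq_rpow_half]
  exact Finset.single_le_sum
    (f := fun J : Fin n → Fin d => gagliardoSq U (s - n) (weakDeriv U J u))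
    (fun _ _ => zero_le) (Finset.mem_univ J)

lemma add_mem_thickening {x h : E d} (hx : x ∈ Ω) (hh : ‖h‖ < δ₀) :
    x + h ∈ Metric.thickening δ₀ Ω :=
  Metric.mem_thickening_iff.2 ⟨x, hx, by simpa [dist_eq_norm] using hh⟩

/-- Finitely many functions in `L²` have uniformly bounded second differences. -/
lemma exists_forall_eLpNorm_secDiff_le {V : Set (E d)} {ι : Type*} [Fintype ι] {f : ι → E d → ℝ}
    (hf : ∀ i, MemLp (f i) 2 volume) :
    ∃ η : ℝ, 0 ≤ η ∧ ∀ i, ∀ v : E d,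
      eLpNorm (secDiff (f i) v) 2 (volume.restrict V) ≤ ENNReal.ofReal η := by
  have h1 : ∀ i, ∀ a : E d, eLpNorm (fun x => f i (x + a) - f i x) 2 (volume.restrict V)
      ≤ eLpNorm (f i) 2 volume + eLpNorm (f i) 2 volume := by
    intro i a
    refine (eLpNorm_mono_measure _ Measure.restrict_le_self).trans ?_
    refine (eLpNorm_sub_le (memLp_translate (hf i) a).1 (hf i).1 (by norm_num)).trans ?_
    rw [eLpNorm_translate (hf i).1]
  set B : ι → ℝ≥0∞ := fun i => eLpNorm (f i) 2 volume + eLpNorm (f i) 2 volume +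
    (eLpNorm (f i) 2 volume + eLpNorm (f i) 2 volume) with hB
  have hBtop : ∀ i, B i ≠ ⊤ := fun i => by simp [hB, (hf i).2.ne]
  refine ⟨(∑ i, B i).toReal, ENNReal.toReal_nonneg, fun i v => ?_⟩
  rw [ENNReal.ofReal_toReal (ENNReal.sum_ne_top.2 fun i _ => hBtop i)]
  refine (eLpNorm_secDiff_le (hf i) v).trans ((add_le_add (h1 i v) (h1 i (-v))).trans ?_)
  exact Finset.single_le_sum (f := B) (fun _ _ => zero_le) (Finset.mem_univ i)

/-- A constant in the modulus of the second derivatives. -/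
noncomputable def modulusConst (d : ℕ) : ℝ := (2 + 2 * d) * √(gagliardoConst d) + d * d

lemma modulusConst_nonneg (d : ℕ) : 0 ≤ modulusConst d := by unfold modulusConst; positivity

namespace MemSobolev

lemma memLp (hU : IsOpen U) (h : MemSobolev s U u) : MemLp u 2 (volume.restrict U) :=
  memLp_of_hasWeakDeriv_zero hU (h.1 0 (Nat.zero_le _) ![])

lemma memLp_weakDeriv (hU : IsOpen U) (h : MemSobolev s U u) {n : ℕ} (hn : n ≤ ⌊s⌋₊)
    (J : Fin n → Fin d) : MemLp (weakDeriv U J u) 2 (volume.restrict U) :=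
  (weakDeriv_spec hU (h.1 n hn J)).2

lemma isWeakDeriv (hU : IsOpen U) (h : MemSobolev s U u) {n : ℕ} (hn : n ≤ ⌊s⌋₊)
    (J : Fin n → Fin d) (j : Fin d) :
    IsWeakDeriv U J (globalComp U u j) (globalComp U (weakDeriv U J u) j) :=
  (weakDeriv_spec hU (h.1 n hn J)).1.isWeakDeriv_globalComp hU (h.memLp hU) (h.memLp_weakDeriv hU hn J) j

lemma vectorModulus (hΩ : IsOpen Ω) (hδ₀ : 0 < δ₀)
    (h : MemSobolev s (Metric.thickening δ₀ Ω) u) (hs : 2 ≤ ⌊s⌋₊) {ρ η : ℝ} (hρ : ρ ≤ δ₀)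
    (hη : 0 ≤ η) (hmod : ∀ j k l, ∀ v : E d, ‖v‖ < ρ →
      eLpNorm (secDiff (globalComp (Metric.thickening δ₀ Ω)
        (weakDeriv (Metric.thickening δ₀ Ω) ![k, l] u) j) v) 2 (volume.restrict Ω)
        ≤ ENNReal.ofReal η) :
    VectorModulus (Metric.thickening δ₀ Ω) Ω ρ η u := by
  have hU : IsOpen (Metric.thickening δ₀ Ω) := Metric.isOpen_thickening
  have h1 : 1 ≤ ⌊s⌋₊ := by omega
  exact
    { isOpen := hU
      measurableSet := hΩ.measurableSet
      subset := Metric.self_subset_thickening hδ₀ Ω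
      memLp := h.memLp hU
      memLp_gradient := fun k => h.memLp_weakDeriv hU h1 _
      memLp_hessian := fun k l => h.memLp_weakDeriv hU hs _
      weak_gradient := fun j k => h.isWeakDeriv hU h1 _ _
      modulus := fun j =>
        { isOpen := hΩ
          add_mem := fun x hx v hv => add_mem_thickening hx (hv.trans_le hρ)
          memLp := memLp_globalComp hU (h.memLp hU) j
          measurable := measurable_globalComp hU j
          memLp_hessian := fun k l => memLp_globalComp hU (h.memLp_weakDeriv hU hs _) j
          measurable_hessian := fun k l => measurable_globalComp hU j
          weak := fun k l => h.isWeakDeriv hU hs _ _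
          nonneg := hη
          modulus := hmod j } }

/-- In `L²`, the second differences of the second derivatives are bounded. -/
lemma exists_modulus_le (h : MemSobolev s (Metric.thickening δ₀ Ω) u) (hs : 2 ≤ ⌊s⌋₊) :
    ∃ η : ℝ, 0 ≤ η ∧ ∀ j k l, ∀ v : E d,
      eLpNorm (secDiff (globalComp (Metric.thickening δ₀ Ω)
        (weakDeriv (Metric.thickening δ₀ Ω) ![k, l] u) j) v) 2 (volume.restrict Ω)
        ≤ ENNReal.ofReal η := by
  have hU : IsOpen (Metric.thickening δ₀ Ω) := Metric.isOpen_thickening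
  have hDm : ∀ i : Fin d × Fin d × Fin d, MemLp (globalComp (Metric.thickening δ₀ Ω)
      (weakDeriv (Metric.thickening δ₀ Ω) ![i.2.1, i.2.2] u) i.1) 2 volume := fun i =>
    memLp_globalComp hU (h.memLp_weakDeriv hU hs _) _
  obtain ⟨η, hη⟩ := exists_forall_eLpNorm_secDiff_le (V := Ω) hDm
  exact ⟨η, hη.1, fun j k l v => hη.2 (j, k, l) v⟩

/-- The first differences of the derivatives of top order, in the fractional case. -/
lemma eLpNorm_sub_translate_le (hd : 0 < d) (hΩ : IsOpen Ω)
    (h : MemSobolev s (Metric.thickening δ₀ Ω) u) {n : ℕ} (hn : ⌊s⌋₊ = n) (hsn : s ≠ n)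
    (hs0 : 0 ≤ s) (J : Fin n → Fin d) (j : Fin d) {v : E d} (hv : ‖v‖ < δ₀) :
    eLpNorm (fun x => globalComp (Metric.thickening δ₀ Ω) (weakDeriv (Metric.thickening δ₀ Ω) J u) j
        (x + v) - globalComp (Metric.thickening δ₀ Ω) (weakDeriv (Metric.thickening δ₀ Ω) J u) j x) 2
      (volume.restrict Ω) ≤
      ENNReal.ofReal (√(gagliardoConst d) * (sobolevSeminorm s (Metric.thickening δ₀ Ω) u).toReal
        * ‖v‖ ^ (s - n)) := by
  set U := Metric.thickening δ₀ Ω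
  have hU : IsOpen U := Metric.isOpen_thickening
  have hr : 0 ≤ s - n := by rw [← hn]; exact sub_nonneg.2 (Nat.floor_le hs0)
  have hG : 0 ≤ gagliardoConst d := by unfold gagliardoConst; positivity
  have h1 := eLpNorm_sub_translate_sq_le (f := globalComp U (weakDeriv U J u) j) (h := v) hd
    hU.measurableSet hΩ.measurableSet (measurable_globalComp hU j) hr
    (fun x hx y hy => add_mem_thickening hx (hy.trans_lt hv))
  have h2 : gagliardo U (s - n) (globalComp U (weakDeriv U J u) j) ≤ sobolevSeminorm s U u ^ 2 :=
    (gagliardo_globalComp_le hU (h.memLp_weakDeriv hU hn.ge J).1 _ j).trans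
      (gagliardoSq_weakDeriv_le_sobolevSeminorm hn hsn J)
  rw [← ENNReal.pow_le_pow_left_iff two_ne_zero]
  refine (h1.trans (mul_le_mul_right h2 _)).trans (le_of_eq ?_)
  rw [← ENNReal.ofReal_toReal h.2.ne, ENNReal.toReal_ofReal ENNReal.toReal_nonneg,
    ← ENNReal.ofReal_pow ENNReal.toReal_nonneg, ← ENNReal.ofReal_mul (by positivity),
    ← ENNReal.ofReal_pow (by positivity)]
  congr 1
  rw [mul_pow, mul_pow, Real.sq_sqrt hG, ← Real.rpow_natCast (‖v‖ ^ (s - n)),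
    ← Real.rpow_mul (norm_nonneg v)]
  push_cast
  ring_nf

/-- The second differences of the second derivatives of `u ∈ W^{2+α,2}`, for `α ≠ 0, 1`: they are
differences of `∂²u` if `α < 1`, integrals of differences of `∂³u` if `1 < α < 2`, and integrals of
`∂⁴u` if `α = 2`. -/
lemma eLpNorm_secDiff_hessian_le (hd : 0 < d) (hΩ : IsOpen Ω)
    (h : MemSobolev (2 + α) (Metric.thickening δ₀ Ω) u) (hα0 : 0 < α) (hα2 : α ≤ 2) (hα1 : α ≠ 1)
    (j k l : Fin d) {v : E d} (hv : ‖v‖ < δ₀) :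
    eLpNorm (secDiff (globalComp (Metric.thickening δ₀ Ω)
        (weakDeriv (Metric.thickening δ₀ Ω) ![k, l] u) j) v) 2 (volume.restrict Ω) ≤
      ENNReal.ofReal (modulusConst d *
        (sobolevSeminorm (2 + α) (Metric.thickening δ₀ Ω) u).toReal * ‖v‖ ^ α) := by
  set S := (sobolevSeminorm (2 + α) (Metric.thickening δ₀ Ω) u).toReal with hS
  set U := Metric.thickening δ₀ Ω
  have hU : IsOpen U := Metric.isOpen_thickening
  have hS0 : 0 ≤ S := ENNReal.toReal_nonneg
  have h2 : 2 ≤ ⌊2 + α⌋₊ := Nat.le_floor (by push_cast; linarith)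
  have hDm := memLp_globalComp hU (h.memLp_weakDeriv hU h2 ![k, l]) j
  have hadd : ∀ x ∈ Ω, ∀ a : E d, ‖a‖ ≤ ‖v‖ → x + a ∈ U := fun x hx a ha =>
    add_mem_thickening hx (ha.trans_lt hv)
  have hroot : 0 ≤ √(gagliardoConst d) := Real.sqrt_nonneg _
  have hmono : ∀ {c : ℝ}, c ≤ modulusConst d →
      ENNReal.ofReal (c * S * ‖v‖ ^ α) ≤ ENNReal.ofReal (modulusConst d * S * ‖v‖ ^ α) := by
    intro c hc
    apply ENNReal.ofReal_le_ofReal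
    gcongr
  rcases lt_or_gt_of_ne hα1 with hlt | hgt
  · have hn : ⌊2 + α⌋₊ = 2 := (Nat.floor_eq_iff (by linarith)).2 ⟨by push_cast; linarith,
      by push_cast; linarith⟩
    have hne : 2 + α ≠ (2 : ℕ) := by push_cast; linarith
    have hfirst : ∀ a : E d, ‖a‖ = ‖v‖ → _ := fun a ha =>
      h.eLpNorm_sub_translate_le hd hΩ hn hne (by linarith) ![k, l] j (v := a) (ha ▸ hv)
    have e : 2 + α - (2 : ℕ) = α := by push_cast; ring
    rw [e] at hfirst
    refine (eLpNorm_secDiff_le hDm v).trans ?_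
    refine (add_le_add (hfirst v rfl) (hfirst (-v) (norm_neg v))).trans ?_
    rw [norm_neg, ← ENNReal.ofReal_add (by positivity) (by positivity)]
    refine le_trans (le_of_eq ?_) (hmono (c := 2 * √(gagliardoConst d)) ?_)
    · congr 1; ring
    · unfold modulusConst
      nlinarith [mul_nonneg (Nat.cast_nonneg (α := ℝ) d) hroot,
        mul_nonneg (Nat.cast_nonneg (α := ℝ) d) (Nat.cast_nonneg (α := ℝ) d)]
  rcases lt_or_eq_of_le hα2 with hlt | rfl
  · have hn : ⌊2 + α⌋₊ = 3 := (Nat.floor_eq_iff (by linarith)).2 ⟨by push_cast; linarith,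
      by push_cast; linarith⟩
    have hne : 2 + α ≠ (3 : ℕ) := by push_cast; intro h; exact hα1 (by linarith)
    have e : 2 + α - (3 : ℕ) = α - 1 := by push_cast; ring
    have h3 := eLpNorm_secDiff_le_of_gradient (V := Ω) hΩ hDm
      (g := fun m => globalComp U (weakDeriv U ![k, l, m] u) j)
      (fun m => memLp_globalComp hU (h.memLp_weakDeriv hU hn.ge _) j)
      (fun m => (h.isWeakDeriv hU h2 ![k, l] j).third (h.isWeakDeriv hU hn.ge ![k, l, m] j))
      (v := v) hadd (C := √(gagliardoConst d) * S * ‖v‖ ^ (α - 1)) (by positivity)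
      (fun m a ha => (h.eLpNorm_sub_translate_le hd hΩ hn hne (by linarith) ![k, l, m] j
        (ha.trans_lt hv)).trans (by
          rw [e, ← hS]
          apply ENNReal.ofReal_le_ofReal
          gcongr))
    refine h3.trans (le_trans (le_of_eq ?_) (hmono (c := 2 * d * √(gagliardoConst d)) ?_))
    · rcases eq_or_ne v 0 with rfl | hv0
      · simp [Real.zero_rpow hα0.ne']
      · congr 1
        rw [Real.rpow_sub_one (norm_ne_zero_iff.2 hv0)]
        have := norm_ne_zero_iff.2 hv0
        field_simp
    · unfold modulusConst
      nlinarith [mul_nonneg (Nat.cast_nonneg (α := ℝ) d) (Nat.cast_nonneg (α := ℝ) d)]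
  · have hn : (2 + 2 : ℝ) = (4 : ℕ) := by norm_num
    have hfl : ⌊(2 + 2 : ℝ)⌋₊ = 4 := by rw [hn, Nat.floor_natCast]
    have h4 := eLpNorm_secDiff_le_of_hessian (V := Ω) hΩ hDm
      (g := fun m n => globalComp U (weakDeriv U ![k, l, m, n] u) j)
      (fun m n => memLp_globalComp hU (h.memLp_weakDeriv hU hfl.ge _) j)
      (fun m n => (h.isWeakDeriv hU h2 ![k, l] j).fourth
        (h.isWeakDeriv hU hfl.ge ![k, l, m, n] j))
      (v := v) hadd (C := S) (fun m n => by
        rw [hS, ENNReal.ofReal_toReal h.2.ne]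
        exact (eLpNorm_globalComp_le hU (h.memLp_weakDeriv hU hfl.ge _).1 j).trans
          (eLpNorm_weakDeriv_le_sobolevSeminorm hn _))
    refine h4.trans (le_trans (le_of_eq ?_) (hmono (c := d * d) ?_))
    · rw [Real.rpow_two]
    · unfold modulusConst
      have : 0 ≤ (2 + 2 * (d : ℝ)) * √(gagliardoConst d) := by positivity
      linarith

/-- For `α ∈ {0, 1}` the second differences of `∂²u` are `o(|h|^α)`, as translation is continuous
in `L²`. -/
lemma exists_eLpNorm_secDiff_hessian_le (hδ₀ : 0 < δ₀) (hΩ : IsOpen Ω)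
    (h : MemSobolev (2 + α) (Metric.thickening δ₀ Ω) u) (hα : α = 0 ∨ α = 1) {ε : ℝ}
    (hε : 0 < ε) : ∃ ρ : ℝ, 0 < ρ ∧ ρ ≤ δ₀ ∧ ∀ j k l, ∀ v : E d, ‖v‖ < ρ →
      eLpNorm (secDiff (globalComp (Metric.thickening δ₀ Ω)
        (weakDeriv (Metric.thickening δ₀ Ω) ![k, l] u) j) v) 2 (volume.restrict Ω) ≤
      ENNReal.ofReal (ε * ‖v‖ ^ α) := by
  set U := Metric.thickening δ₀ Ω
  have hU : IsOpen U := Metric.isOpen_thickening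
  have unif : ∀ {ι : Type} [Finite ι] (f : ι → E d → ℝ), (∀ i, MemLp (f i) 2 volume) →
      ∀ {ε : ℝ}, 0 < ε → ∃ ρ : ℝ, 0 < ρ ∧ ρ ≤ δ₀ ∧ ∀ i, ∀ v : E d, ‖v‖ < ρ →
        eLpNorm (fun x => f i (x + v) - f i x) 2 (volume.restrict Ω) ≤ ENNReal.ofReal ε := by
    intro ι _ f hf ε hε
    have h1 : ∀ i, ∀ᶠ ρ in nhdsWithin (0 : ℝ) (Set.Ioi 0), ∀ v : E d, ‖v‖ < ρ →
        eLpNorm (fun x => f i (x + v) - f i x) 2 (volume.restrict Ω) ≤ ENNReal.ofReal ε := by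
      intro i
      obtain ⟨ρ, hρ, h2⟩ := exists_eLpNorm_sub_translate_le (hf i) hε
      filter_upwards [Ioo_mem_nhdsGT hρ] with ρ' hρ' v hv
      exact (eLpNorm_mono_measure _ Measure.restrict_le_self).trans (h2 v (hv.trans hρ'.2))
    obtain ⟨ρ, h2, h3⟩ := ((Filter.eventually_all.2 h1).and (Ioc_mem_nhdsGT hδ₀)).exists
    exact ⟨ρ, h3.1, h3.2, h2⟩
  rcases hα with rfl | rfl
  · have hn : 2 ≤ ⌊(2 + 0 : ℝ)⌋₊ := by norm_num
    obtain ⟨ρ, hρ, hρδ, h1⟩ := unif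
      (fun i : Fin d × Fin d × Fin d => globalComp U (weakDeriv U ![i.2.1, i.2.2] u) i.1)
      (fun i => memLp_globalComp hU (h.memLp_weakDeriv hU hn _) _) (half_pos hε)
    refine ⟨ρ, hρ, hρδ, fun j k l v hv => ?_⟩
    refine (eLpNorm_secDiff_le (memLp_globalComp hU (h.memLp_weakDeriv hU hn _) _) v).trans ?_
    refine (add_le_add (h1 (j, k, l) v hv) (h1 (j, k, l) (-v) (by rwa [norm_neg]))).trans ?_
    rw [← ENNReal.ofReal_add (by positivity) (by positivity)]
    simp
  · have hn : ⌊(2 + 1 : ℝ)⌋₊ = 3 := by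
      rw [show (2 + 1 : ℝ) = (3 : ℕ) by norm_num, Nat.floor_natCast]
    have h2 : 2 ≤ ⌊(2 + 1 : ℝ)⌋₊ := by rw [hn]; norm_num
    obtain ⟨ρ, hρ, hρδ, h1⟩ := unif
      (fun i : (Fin d × Fin d) × Fin d × Fin d =>
        globalComp U (weakDeriv U ![i.1.2, i.2.1, i.2.2] u) i.1.1)
      (fun i => memLp_globalComp hU (h.memLp_weakDeriv hU hn.ge _) _)
      (by positivity : 0 < ε / (2 * d + 1))
    refine ⟨ρ, hρ, hρδ, fun j k l v hv => ?_⟩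
    have h3 := eLpNorm_secDiff_le_of_gradient (V := Ω) hΩ
      (memLp_globalComp hU (h.memLp_weakDeriv hU h2 ![k, l]) j)
      (g := fun m => globalComp U (weakDeriv U ![k, l, m] u) j)
      (fun m => memLp_globalComp hU (h.memLp_weakDeriv hU hn.ge _) j)
      (fun m => (h.isWeakDeriv hU h2 ![k, l] j).third (h.isWeakDeriv hU hn.ge ![k, l, m] j))
      (v := v) (fun x hx a ha => add_mem_thickening hx ((ha.trans_lt hv).trans_le hρδ))
      (C := ε / (2 * d + 1)) (by positivity)
      (fun m a ha => h1 ((j, k), l, m) a (ha.trans_lt hv))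
    refine h3.trans (ENNReal.ofReal_le_ofReal ?_)
    rw [Real.rpow_one]
    gcongr
    rw [mul_div_assoc', div_le_iff₀ (by positivity)]
    linarith

end MemSobolev

end Sobolev

/-! ### The consistency estimate -/

/-- The constant that both consistency errors have in terms of the modulus of `∂²u`. -/
noncomputable def errorConst (d : ℕ) : ℝ := d ^ 6 + 2 * d ^ 5 * (d + 2)

lemma errorConst_nonneg (d : ℕ) : 0 ≤ errorConst d := by unfold errorConst; positivity

section

variable {U Ω : Set (E d)} {ρ η δ C : ℝ} {K : ℝ → ℝ} {u : E d → E d}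

lemma VectorModulus.eLpNorm_opA_sub_le_errorConst (H : VectorModulus U Ω ρ η u)
    (hη : 0 ≤ η) (hK : IsKernel d δ K) (hm : 0 < weightedVolume d K δ)
    (hC : NormalizedA d C K δ) (hδ : 2 * δ ≤ ρ) :
    eLpNorm (fun x => opA C K δ u x - gradDiv U u x) 2 (volume.restrict Ω) ≤
      ENNReal.ofReal (errorConst d * η) := by
  refine (H.eLpNorm_opA_sub_le hK hm hC hδ).trans (ENNReal.ofReal_le_ofReal ?_)
  unfold errorConst
  gcongr
  exact le_add_of_nonneg_right (by positivity)

lemma VectorModulus.eLpNorm_opB_sub_le_errorConst (H : VectorModulus U Ω ρ η u)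
    (hη : 0 ≤ η) (hK : IsKernel d δ K) (hm : 0 < weightedVolume d K δ)
    (hC : NormalizedB d C K δ) (hδ : δ ≤ ρ) :
    eLpNorm (fun x => opB C K δ u x - (gradDiv U u x + divSymGrad U u x)) 2 (volume.restrict Ω) ≤
      ENNReal.ofReal (errorConst d * η) := by
  refine (H.eLpNorm_opB_sub_le hK hm hC hδ).trans (ENNReal.ofReal_le_ofReal ?_)
  unfold errorConst
  gcongr
  exact le_add_of_nonneg_left (by positivity)

lemma VectorModulus.memLp_gradDiv (H : VectorModulus U Ω ρ η u) :
    MemLp (gradDiv U u) 2 (volume.restrict Ω) := by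
  refine MemLp.of_eval_piLp fun i => ?_
  exact memLp_finsetSum Finset.univ fun j _ => ((H.memLp_hessian i j).mono_measure
    (Measure.restrict_mono H.subset le_rfl)).eval_piLp j

lemma VectorModulus.memLp_divSymGrad (H : VectorModulus U Ω ρ η u) :
    MemLp (divSymGrad U u) 2 (volume.restrict Ω) := by
  refine MemLp.of_eval_piLp fun i => ?_
  have h : ∀ k l j, MemLp (fun x => weakDeriv U ![k, l] u x j) 2 (volume.restrict Ω) :=
    fun k l j => ((H.memLp_hessian k l).mono_measure
      (Measure.restrict_mono H.subset le_rfl)).eval_piLp j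
  exact memLp_finsetSum Finset.univ fun j _ => (h j j i).add (h j i j)

lemma VectorModulus.memLp_opA (H : VectorModulus U Ω ρ η u) (hη : 0 ≤ η)
    (hadd : ∀ x ∈ Ω, ∀ h : E d, ‖h‖ < ρ → x + h ∈ U) (hK : IsKernel d δ K)
    (hm : 0 < weightedVolume d K δ) (hC : NormalizedA d C K δ) (hδ : 2 * δ ≤ ρ) :
    MemLp (opA C K δ u) 2 (volume.restrict Ω) := by
  have hmeas : AEStronglyMeasurable (opA C K δ u) (volume.restrict Ω) := by
    refine (stronglyMeasurable_opA (C := C) (u := globalRep U u) hK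
      (measurable_globalRep H.isOpen)).aestronglyMeasurable.congr ?_
    filter_upwards [ae_restrict_mem H.measurableSet] with x hx
    exact opA_congr H.isOpen (globalRep_ae_eq H.isOpen H.memLp.1)
      fun z hz => hadd x hx z (hz.trans_le hδ)
  have h1 : MemLp (fun x => opA C K δ u x - gradDiv U u x) 2 (volume.restrict Ω) :=
    ⟨hmeas.sub H.memLp_gradDiv.1,
      (H.eLpNorm_opA_sub_le_errorConst hη hK hm hC hδ).trans_lt ENNReal.ofReal_lt_top⟩
  refine (h1.add H.memLp_gradDiv).ae_eq (.of_forall fun x => ?_)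
  simp

lemma VectorModulus.memLp_opB (H : VectorModulus U Ω ρ η u) (hη : 0 ≤ η)
    (hadd : ∀ x ∈ Ω, ∀ h : E d, ‖h‖ < ρ → x + h ∈ U) (hK : IsKernel d δ K)
    (hm : 0 < weightedVolume d K δ) (hC : NormalizedB d C K δ) (hδ : δ ≤ ρ) :
    MemLp (opB C K δ u) 2 (volume.restrict Ω) := by
  have hmeas : AEStronglyMeasurable (opB C K δ u) (volume.restrict Ω) := by
    refine (stronglyMeasurable_opB (C := C) (u := globalRep U u) hK
      (measurable_globalRep H.isOpen)).aestronglyMeasurable.congr ?_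
    filter_upwards [ae_restrict_mem H.measurableSet,
      ae_restrict_of_ae_restrict_of_subset H.subset (globalRep_ae_eq H.isOpen H.memLp.1)]
      with x hx hux
    exact opB_congr H.isOpen (globalRep_ae_eq H.isOpen H.memLp.1)
      (fun z hz => hadd x hx z (hz.trans_le hδ)) hux
  have h0 := H.memLp_gradDiv.add H.memLp_divSymGrad
  have h1 : MemLp (fun x => opB C K δ u x - (gradDiv U u x + divSymGrad U u x)) 2
      (volume.restrict Ω) :=
    ⟨hmeas.sub h0.1,
      (H.eLpNorm_opB_sub_le_errorConst hη hK hm hC hδ).trans_lt ENNReal.ofReal_lt_top⟩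
  refine (h1.add h0).ae_eq (.of_forall fun x => ?_)
  simp

end

lemma rpow_le_of_norm_lt_two_mul {α δ : ℝ} (hα0 : 0 ≤ α) (hα2 : α ≤ 2) (hδ : 0 < δ) {v : E d}
    (hv : ‖v‖ < 2 * δ) : ‖v‖ ^ α ≤ 4 * δ ^ α := by
  calc ‖v‖ ^ α ≤ (2 * δ) ^ α := Real.rpow_le_rpow (norm_nonneg v) hv.le hα0
    _ = 2 ^ α * δ ^ α := Real.mul_rpow (by norm_num) hδ.le
    _ ≤ 4 * δ ^ α := by
      gcongr
      calc (2 : ℝ) ^ α ≤ 2 ^ (2 : ℝ) := Real.rpow_le_rpow_of_exponent_le (by norm_num) hα2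
        _ = 4 := by norm_num

end Peridynamics

open Peridynamics in
theorem theorem4 (d : ℕ) (hd : 2 ≤ d) (α : ℝ) (hα0 : 0 ≤ α) (hα2 : α ≤ 2) :
    ∃ Λ : ℝ, 0 < Λ ∧
      ∀ (Ω : Set (E d)), IsOpen Ω → ∀ δ₀ : ℝ, 0 < δ₀ →
      ∀ (K : ℝ → ℝ → ℝ) (CA CB : ℝ),
        (∀ δ : ℝ, 0 < δ → IsKernel d δ (K δ) ∧ 0 < weightedVolume d (K δ) δ ∧
          NormalizedA d CA (K δ) δ ∧ NormalizedB d CB (K δ) δ) →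
      ∀ u : E d → E d, MemSobolev (2 + α) (Metric.thickening δ₀ Ω) u →
        (∀ δ : ℝ, 0 < δ → δ ≤ δ₀ / 2 →
          MemLp (opA CA (K δ) δ u) 2 (volume.restrict Ω) ∧
          MemLp (opB CB (K δ) δ u) 2 (volume.restrict Ω)) ∧
        ((α = 0 ∨ α = 1) → ∀ ε : ℝ, 0 < ε → ∃ δ₁ : ℝ, 0 < δ₁ ∧ δ₁ ≤ δ₀ / 2 ∧
          ∀ δ : ℝ, 0 < δ → δ ≤ δ₁ →
            eLpNorm (fun x => opA CA (K δ) δ u x - gradDiv (Metric.thickening δ₀ Ω) u x)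
                2 (volume.restrict Ω) < ENNReal.ofReal (ε * δ ^ α) ∧
            eLpNorm (fun x => opB CB (K δ) δ u x -
                (gradDiv (Metric.thickening δ₀ Ω) u x + divSymGrad (Metric.thickening δ₀ Ω) u x))
                2 (volume.restrict Ω) < ENNReal.ofReal (ε * δ ^ α)) ∧
        (0 < α → α ≠ 1 → ∀ δ : ℝ, 0 < δ → δ ≤ δ₀ / 2 →
            eLpNorm (fun x => opA CA (K δ) δ u x - gradDiv (Metric.thickening δ₀ Ω) u x)
                2 (volume.restrict Ω) ≤
              ENNReal.ofReal Λ * sobolevSeminorm (2 + α) (Metric.thickening δ₀ Ω) u *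
                ENNReal.ofReal (δ ^ α) ∧
            eLpNorm (fun x => opB CB (K δ) δ u x -
                (gradDiv (Metric.thickening δ₀ Ω) u x + divSymGrad (Metric.thickening δ₀ Ω) u x))
                2 (volume.restrict Ω) ≤
              ENNReal.ofReal Λ * sobolevSeminorm (2 + α) (Metric.thickening δ₀ Ω) u *
                ENNReal.ofReal (δ ^ α)) := by
  have hc := errorConst_nonneg d
  have hM := modulusConst_nonneg d
  refine ⟨4 * errorConst d * modulusConst d + 1, by positivity, ?_⟩
  intro Ω hΩ δ₀ hδ₀ K CA CB hKall u hu
  have h2 : 2 ≤ ⌊2 + α⌋₊ := Nat.le_floor (by push_cast; linarith)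
  refine ⟨fun δ hδ hδ' => ?_, fun hα ε hε => ?_, fun hα hα1 δ hδ hδ' => ?_⟩
  · obtain ⟨hK, hm, hA, hB⟩ := hKall δ hδ
    obtain ⟨η, hη, hmod⟩ := hu.exists_modulus_le h2
    have H := hu.vectorModulus hΩ hδ₀ h2 le_rfl hη fun j k l v _ => hmod j k l v
    have hadd : ∀ x ∈ Ω, ∀ h : E d, ‖h‖ < δ₀ → x + h ∈ Metric.thickening δ₀ Ω :=
      fun x hx h hh => add_mem_thickening hx hh
    exact ⟨H.memLp_opA hη hadd hK hm hA (by linarith), H.memLp_opB hη hadd hK hm hB (by linarith)⟩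
  · set ε' : ℝ := ε / (4 * (errorConst d + 1)) with hε'
    have hε'0 : 0 < ε' := by positivity
    obtain ⟨ρ, hρ, hρδ, hmod⟩ := hu.exists_eLpNorm_secDiff_hessian_le hδ₀ hΩ hα hε'0
    refine ⟨ρ / 2, by positivity, by linarith, fun δ hδ hδ' => ?_⟩
    obtain ⟨hK, hm, hA, hB⟩ := hKall δ hδ
    have hη : 0 ≤ ε' * (4 * δ ^ α) := by positivity
    have H := hu.vectorModulus hΩ hδ₀ h2 (ρ := 2 * δ) (by linarith) hη fun j k l v hv =>
      (hmod j k l v (by linarith)).trans (ENNReal.ofReal_le_ofReal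
        (mul_le_mul_of_nonneg_left (rpow_le_of_norm_lt_two_mul hα0 hα2 hδ hv) hε'0.le))
    have hlt : ENNReal.ofReal (errorConst d * (ε' * (4 * δ ^ α))) < ENNReal.ofReal (ε * δ ^ α) := by
      rw [ENNReal.ofReal_lt_ofReal_iff (by positivity)]
      have e : errorConst d * (ε' * (4 * δ ^ α))
          = errorConst d / (errorConst d + 1) * (ε * δ ^ α) := by
        rw [hε']; field_simp
      rw [e]
      refine mul_lt_of_lt_one_left (by positivity) ?_
      rw [div_lt_one (by positivity)]
      linarith
    exact ⟨(H.eLpNorm_opA_sub_le_errorConst hη hK hm hA le_rfl).trans_lt hlt,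
      (H.eLpNorm_opB_sub_le_errorConst hη hK hm hB (by linarith)).trans_lt hlt⟩
  · obtain ⟨hK, hm, hA, hB⟩ := hKall δ hδ
    set S := (sobolevSeminorm (2 + α) (Metric.thickening δ₀ Ω) u).toReal with hS
    have hS0 : 0 ≤ S := ENNReal.toReal_nonneg
    have hη : 0 ≤ modulusConst d * S * (4 * δ ^ α) := by positivity
    have H := hu.vectorModulus hΩ hδ₀ h2 (ρ := 2 * δ) (by linarith) hη fun j k l v hv =>
      (hu.eLpNorm_secDiff_hessian_le (by omega) hΩ hα hα2 hα1 j k l (by linarith)).trans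
        (ENNReal.ofReal_le_ofReal (mul_le_mul_of_nonneg_left
          (rpow_le_of_norm_lt_two_mul hα0 hα2 hδ hv) (by positivity)))
    have hle : ENNReal.ofReal (errorConst d * (modulusConst d * S * (4 * δ ^ α))) ≤
        ENNReal.ofReal (4 * errorConst d * modulusConst d + 1) *
          sobolevSeminorm (2 + α) (Metric.thickening δ₀ Ω) u * ENNReal.ofReal (δ ^ α) := by
      rw [← ENNReal.ofReal_toReal hu.2.ne, ← hS, ← ENNReal.ofReal_mul (by positivity),
        ← ENNReal.ofReal_mul (by positivity)]
      apply ENNReal.ofReal_le_ofReal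
      have : 0 ≤ S * δ ^ α := by positivity
      linarith
    exact ⟨(H.eLpNorm_opA_sub_le_errorConst hη hK hm hA le_rfl).trans hle,
      (H.eLpNorm_opB_sub_le_errorConst hη hK hm hB (by linarith)).trans hle⟩
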